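/- All graphs are finite and simple. A geodesic of a graph is a shortest path between two vertices; it is maximal if it is not a subpath of a longer geodesic. A set of vertices is geodesic-transversal if it contains a vertex of every maximal geodesic, and a gt-set is a geodesic-transversal set of minimum cardinality. A leaf is a vertex of degree $1$; an end support vertex is a vertex $u$ that has a leaf neighbor and at least $\deg(u)-1$ leaf neighbors. Smoothing a vertex of degree $2$ means removing it and joining its two neighbors by an edge; $\mathrm{SM}(T)$ is obtained from $T$ by smoothing, one after the other, all vertices of degree $2$. Algorithm (input: a tree $T$). Put $S=\emptyset$ and $T:=\mathrm{SM}(T)$. While $V(T)\neq\emptyset$: choose an arbitrary end support vertex $p$ of $T$, put $S:=S\cup\{p\}$, delete $p$ and all leaf neighbors of $p$ from $T$, and put $T:=\mathrm{SM}(T)$. Return $S$. Theorem. (a) For every tree $T$ of order at least $2$, every execution of the algorithm (whatever end support vertices are chosen, and in whatever order vertices are smoothed) is correct: as long as $V(T)\ne\emptyset$ an end support vertex exists, so that the loop can be continued, the loop is left after finitely many passes, and the returned set $S$ is a gt-set of the input tree. (b) The algorithm can be carried out in linear time: there are a program for a random access machine and a constant $C$ such that, for every tree $T$ with vertices $0,\dots,n-1$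 ($n\ge 1$), given by $n$ and a list of its edges in any order and orientation, the program halts after at most $Cn$ steps, uses only numbers at most $(n+1)^C$ (words of $O(\log n)$ bits), and outputs a list of vertices that form a gt-set of $T$; if $n\ge 2$, this list is the sequence of the vertices selected, in this order, in some execution of the algorithm on $T$. Here the machine has registers and finitely many arrays of natural numbers; loading a constant, copying, addition, truncated subtraction, reading or writing an array cell, and comparing two registers ($<$ or $=$) take one step each. -/

import Mathlib

namespace GeodesicTransversal

/-! ### Maximal geodesics and gt-sets -/

section Geodesics

variable {V : Type*}

/-- A geodesic is a shortest path between its endpoints. -/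
def IsGeodesic (G : SimpleGraph V) {u v : V} (p : G.Walk u v) : Prop :=
  p.length = G.dist u v

/-- A geodesic is maximal if it is not a subpath of a longer geodesic. (Reversing a geodesic gives
a geodesic, so it is enough to look at subpaths traversed in the same direction.) -/
def IsMaximalGeodesic (G : SimpleGraph V) {u v : V} (p : G.Walk u v) : Prop :=
  IsGeodesic G p ∧
    ∀ (x y : V) (q : G.Walk x y), IsGeodesic G q → p.IsSubwalk q → ¬ p.length < q.length

/-- A geodesic-transversal set: it meets every maximal geodesic. -/
def IsTransversal (G : SimpleGraph V) (S : Set V) : Prop :=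
  ∀ (u v : V) (p : G.Walk u v), IsMaximalGeodesic G p → ∃ x ∈ S, x ∈ p.support

/-- A gt-set of a finite graph: a geodesic-transversal set of minimum cardinality. -/
def IsGtSet (G : SimpleGraph V) (S : Set V) : Prop :=
  IsTransversal G S ∧ ∀ S' : Set V, IsTransversal G S' → S.ncard ≤ S'.ncard

end Geodesics

/-! ### The algorithm -/

section Algorithm

variable {V : Type*}

/-- A simple graph whose vertex set is a subset of `V` (equivalently, a subgraph of the complete
graph on `V`). These are the current graphs of the algorithm, which loses vertices and, by
smoothing, gains edges. -/
abbrev PGraph (V : Type*) := (⊤ : SimpleGraph V).Subgraph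

/-- A simple graph on all of `V`, regarded as a `PGraph`. -/
def ofGraph (T : SimpleGraph V) : PGraph V := SimpleGraph.toSubgraph (H := T) le_top

/-- The degree of a vertex. -/
noncomputable def deg (G : PGraph V) (v : V) : ℕ := (G.neighborSet v).ncard

/-- The leaves (vertices of degree one) that are adjacent to `u`. -/
def leafNeighbors (G : PGraph V) (u : V) : Set V := {v | G.Adj u v ∧ deg G v = 1}

/-- An end support vertex: a neighbor of a leaf such that at least `deg u - 1` of the neighbors
of `u` are leaves. -/
def IsEndSupport (G : PGraph V) (u : V) : Prop :=
  (leafNeighbors G u).Nonempty ∧ deg G u - 1 ≤ (leafNeighbors G u).ncard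

/-- `G'` is obtained from `G` by smoothing the vertex `v` of degree two: `v` is removed and its two
neighbors `x`, `y` are joined by an edge. (In a graph without triangles, such as a tree,
`x` and `y` are not adjacent in `G`, so that no parallel edges arise.) -/
def IsSmoothing (G : PGraph V) (v : V) (G' : PGraph V) : Prop :=
  ∃ x y : V, x ≠ y ∧ G.neighborSet v = {x, y} ∧ G'.verts = G.verts \ {v} ∧
    ∀ a b : V, G'.Adj a b ↔
      (G.Adj a b ∧ a ≠ v ∧ b ≠ v) ∨ (a = x ∧ b = y) ∨ (a = y ∧ b = x)

/-- `H = SM(G)`: `H` is obtained from `G` by smoothing vertices of degree two, one after the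
other in some order, until there is no vertex of degree two. -/
def IsSM (G H : PGraph V) : Prop :=
  Relation.ReflTransGen (fun G₁ G₂ => ∃ v, IsSmoothing G₁ v G₂) G H ∧ ∀ v ∈ H.verts, deg H v ≠ 2

/-- The state of the algorithm: the current graph and the vertices selected so far, listed in the
order in which they were selected. -/
structure Config (V : Type*) where
  graph : PGraph V
  chosen : List V

/-- One pass of the loop: while the graph has a vertex, select an arbitrary end support vertex `p`,
add `p` to the selected vertices, delete `p` and all the leaves adjacent to `p`, and smooth all
vertices of degree two. -/
def LoopStep (c c' : Config V) : Prop :=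
  c.graph.verts.Nonempty ∧
    ∃ p, IsEndSupport c.graph p ∧ c'.chosen = c.chosen ++ [p] ∧
      IsSM (c.graph.deleteVerts ({p} ∪ leafNeighbors c.graph p)) c'.graph

/-- The states in which the algorithm, run on `T`, can be before its first pass through the loop:
nothing is selected, and the graph is `SM(T)`. -/
def IsStart (T : SimpleGraph V) (c : Config V) : Prop :=
  IsSM (ofGraph T) c.graph ∧ c.chosen = []

/-- The states that occur at the loop test in some execution of the algorithm on `T`. -/
def Reachable (T : SimpleGraph V) (c : Config V) : Prop :=
  ∃ c₀, IsStart T c₀ ∧ Relation.ReflTransGen LoopStep c₀ c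

/-- Some execution of the algorithm on `T` selects exactly the vertices of `S`, in this order,
and then ends because the graph has no vertex left. -/
def Returns (T : SimpleGraph V) (S : List V) : Prop :=
  ∃ c, Reachable T c ∧ c.graph.verts = ∅ ∧ c.chosen = S

end Algorithm

/-! ### The machine model: a random access machine with bounded words -/

/-- Tests, on the contents of two registers. -/
inductive Test where
  | lt (x y : ℕ)
  | eq (x y : ℕ)

/-- Structured programs for a random access machine with registers `R 0, R 1, …` and one-dimensional
arrays `A 0, A 1, …`, all holding natural numbers; a program names finitely many of them. -/
inductive Prog where
  /-- no operation -/
  | skip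
  /-- `R x := c` -/
  | const (x c : ℕ)
  /-- `R x := R y` -/
  | move (x y : ℕ)
  /-- `R x := R y + R z` -/
  | add (x y z : ℕ)
  /-- `R x := max (R y - R z) 0` -/
  | sub (x y z : ℕ)
  /-- `R x := A a [R y]` -/
  | load (x a y : ℕ)
  /-- `A a [R x] := R y` -/
  | store (a x y : ℕ)
  /-- first `P`, then `Q` -/
  | seq (P Q : Prog)
  /-- `if b then P else Q` -/
  | ite (b : Test) (P Q : Prog)
  /-- `while b do P` -/
  | loop (b : Test) (P : Prog)

/-- The contents of the registers and of the arrays. -/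
structure Store where
  reg : ℕ → ℕ
  arr : ℕ → ℕ → ℕ

/-- Write `k` into register `x`. -/
def Store.setReg (s : Store) (x k : ℕ) : Store :=
  { s with reg := Function.update s.reg x k }

/-- Write `k` into cell `i` of array `a`. -/
def Store.setArr (s : Store) (a i k : ℕ) : Store :=
  { s with arr := Function.update s.arr a (Function.update (s.arr a) i k) }

/-- Whether a test succeeds. -/
def Test.Holds : Test → Store → Prop
  | .lt x y, s => s.reg x < s.reg y
  | .eq x y, s => s.reg x = s.reg y

/-- `Exec W P s s' t`: started in `s`, the program `P` halts in `s'` after exactly `t` steps, and no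
number larger than the word bound `W` is ever produced. Every operation and every evaluation of a
test takes one step. -/
inductive Exec (W : ℕ) : Prog → Store → Store → ℕ → Prop
  | skip (s : Store) : Exec W .skip s s 1
  | const (x c : ℕ) (s : Store) (h : c ≤ W) : Exec W (.const x c) s (s.setReg x c) 1
  | move (x y : ℕ) (s : Store) : Exec W (.move x y) s (s.setReg x (s.reg y)) 1
  | add (x y z : ℕ) (s : Store) (h : s.reg y + s.reg z ≤ W) :
      Exec W (.add x y z) s (s.setReg x (s.reg y + s.reg z)) 1
  | sub (x y z : ℕ) (s : Store) : Exec W (.sub x y z) s (s.setReg x (s.reg y - s.reg z)) 1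
  | load (x a y : ℕ) (s : Store) : Exec W (.load x a y) s (s.setReg x (s.arr a (s.reg y))) 1
  | store (a x y : ℕ) (s : Store) :
      Exec W (.store a x y) s (s.setArr a (s.reg x) (s.reg y)) 1
  | seq {P Q : Prog} {s s' s'' : Store} {t t' : ℕ}
      (h : Exec W P s s' t) (h' : Exec W Q s' s'' t') : Exec W (.seq P Q) s s'' (t + t')
  | ite_true {b : Test} {P Q : Prog} {s s' : Store} {t : ℕ}
      (hb : b.Holds s) (h : Exec W P s s' t) : Exec W (.ite b P Q) s s' (1 + t)
  | ite_false {b : Test} {P Q : Prog} {s s' : Store} {t : ℕ}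
      (hb : ¬ b.Holds s) (h : Exec W Q s s' t) : Exec W (.ite b P Q) s s' (1 + t)
  | loop_true {b : Test} {P : Prog} {s s' s'' : Store} {t t' : ℕ}
      (hb : b.Holds s) (h : Exec W P s s' t) (h' : Exec W (.loop b P) s' s'' t') :
      Exec W (.loop b P) s s'' (1 + t + t')
  | loop_false {b : Test} {P : Prog} {s : Store}
      (hb : ¬ b.Holds s) : Exec W (.loop b P) s s 1

/-! ### Input and output -/

/-- `es` lists the edges of `T`: every edge occurs exactly once, in one of its two orientations. -/
def IsEdgeList {n : ℕ} (T : SimpleGraph (Fin n)) (es : List (Fin n × Fin n)) : Prop :=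
  (es.map fun e => s(e.1, e.2)).Nodup ∧
    ∀ e : Sym2 (Fin n), e ∈ es.map (fun e => s(e.1, e.2)) ↔ e ∈ T.edgeSet

/-- The input: `n` is in register `0`, the first and the second endpoints of the listed edges are
in the arrays `0` and `1`, and everything else is `0`. -/
def inputStore (n : ℕ) (es : List (Fin n × Fin n)) : Store where
  reg x := if x = 0 then n else 0
  arr a i :=
    if a = 0 then (es.map fun e => (e.1 : ℕ)).getD i 0
    else if a = 1 then (es.map fun e => (e.2 : ℕ)).getD i 0
    else 0

/-- The output: register `1` holds the length of the list `S`, and array `2` holds its entries. -/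
def IsOutput {n : ℕ} (s : Store) (S : List (Fin n)) : Prop :=
  s.reg 1 = S.length ∧ ∀ (i : ℕ) (h : i < S.length), s.arr 2 i = (S[i] : ℕ)

end GeodesicTransversal

/-!
In a tree with at least two vertices the maximal geodesics are the paths between two different
leaves, so a set is geodesic-transversal exactly if it separates the leaves (`isTransversal_iff`):
no two leaves are joined by a walk that avoids the set. This notion makes sense for every graph that
occurs in the algorithm. Smoothing a vertex does not change the leaves, and a smoothed vertex of a
separating set can be replaced by one of its neighbors, so the minimum size of a separating set
stays the same. If `p` is an end support vertex of a graph without vertices of degree two, every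
separating set contains `p` or a leaf adjacent to `p` (`SeparatesLeaves.exists_mem_support`), the
rest of it separates the leaves of the graph without these vertices, and conversely adding `p` to a
separating set of the smaller graph gives one of the larger graph. Hence each pass of the loop
selects one vertex and lowers the minimum by one, which is `LoopInvariant`. Only forests without
isolated vertices occur; a forest is handled through an order in which every vertex has at most one
smaller neighbor, because such an order survives deletions and smoothings, and because the largest
vertex that is not a leaf is an end support vertex.

For the linear-time implementation the tree is rooted at a leaf `r`, and it is pruned bottom-up. The
program stores, for every vertex, only the number and the sum of its remaining neighbors; when a
single neighbor is left, the sum is this neighbor, the parent. Every vertex also counts the leaves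
that are still present above it. A vertex with at least two of them is selected and reports nothing
to its parent; otherwise the count is passed on. To see that this is an execution of the algorithm,
its current graph is identified with a Hasse diagram: for a set `L` of remaining leaves,
`TreeOrder.span` consists of `L` and of the meets of its elements, and the Hasse diagram of the tree
order on this set is the smoothed graph. Any set between `span L` and the vertices below `L` can be
smoothed to `span L` (`TreeOrder.IsLeafSet.smoothings`), and the selection of `v` removes exactly
the leaves above `v` from `L` (`TreeOrder.IsLeafSet.isSM_deleteSupport`). Since the root is a leaf,
every vertex selected in this way really has degree at least three; only when the root and one other
leaf are left does a single edge remain, and then the root is selected. The running time is bounded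
by a budget that pays a constant for each visited and for each pruned vertex (`Runs.loop`).
-/

namespace GeodesicTransversal

/-! ### Maximal geodesics of trees -/

section TreeGeodesics

variable {V : Type*} {T : SimpleGraph V}

theorem isGeodesic_of_isPath (hT : T.IsAcyclic) {u v : V} {p : T.Walk u v} (hp : p.IsPath) :
    IsGeodesic T p := by
  obtain ⟨q, hq, hlen⟩ := p.reachable.exists_path_of_dist
  have := (hT.subsingleton_path u v).elim ⟨p, hp⟩ ⟨q, hq⟩
  have h : p = q := congrArg Subtype.val this
  rw [IsGeodesic, h, hlen]

/-- In a rooted tree every vertex has at most one neighbor that is closer to the root. -/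
theorem eq_of_dist_lt (hT : T.IsTree) {r v x y : V} (hx : T.Adj v x) (hy : T.Adj v y)
    (hdx : T.dist r x < T.dist r v) (hdy : T.dist r y < T.dist r v) : x = y := by
  have key : ∀ z, T.Adj v z → T.dist r z < T.dist r v →
      ∃ p : T.Walk r v, p.IsPath ∧ p.penultimate = z := by
    intro z hz hd
    obtain ⟨q, hq, hlen⟩ := hT.connected.exists_path_of_dist r z
    refine ⟨q.concat hz.symm, ?_, by simp⟩
    apply SimpleGraph.Walk.isPath_of_length_eq_dist
    have := hT.dist_eq_dist_add_one_of_adj r hz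
    rw [SimpleGraph.Walk.length_concat]
    omega
  obtain ⟨p, hp, rfl⟩ := key x hx hdx
  obtain ⟨q, hq, rfl⟩ := key y hy hdy
  have := (hT.isAcyclic.subsingleton_path r v).elim ⟨p, hp⟩ ⟨q, hq⟩
  rw [show p = q from congrArg Subtype.val this]

theorem deg_eq_one_iff {G : PGraph V} {v : V} : deg G v = 1 ↔ ∃ w, G.neighborSet v = {w} :=
  Set.ncard_eq_one

/-- The last vertex of a maximal geodesic of a tree with at least two vertices is a leaf, and it
differs from the first one: otherwise the geodesic could be extended beyond its end. -/
theorem IsMaximalGeodesic.deg_end [Nontrivial V] (hT : T.IsTree) {u v : V} {p : T.Walk u v}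
    (hp : IsMaximalGeodesic T p) : deg (ofGraph T) v = 1 ∧ u ≠ v := by
  have hpath : p.IsPath := p.isPath_of_length_eq_dist hp.1
  have hmem : ∀ w, T.Adj v w → w ∈ p.support := by
    intro w hw
    by_contra hws
    exact hp.2 _ _ (p.concat hw) (isGeodesic_of_isPath hT.isAcyclic (hpath.concat hws hw))
      (p.isSubwalk_concat hw) (by simp)
  have hpen : ∀ w, T.Adj v w → w = p.penultimate := fun w hw =>
    hT.isAcyclic.eq_penultimate_of_adj_end hpath hw (hmem w hw)
  obtain ⟨w, hw⟩ := hT.connected.preconnected.exists_adj_of_nontrivial v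
  constructor
  · rw [deg_eq_one_iff]
    refine ⟨w, Set.eq_singleton_iff_unique_mem.2 ⟨hw, fun x hx => ?_⟩⟩
    rw [hpen w hw, hpen x hx]
  · rintro rfl
    have h2 := hmem w hw
    rw [(SimpleGraph.Walk.isPath_iff_nil.1 hpath).eq_nil] at h2
    simp only [SimpleGraph.Walk.support_nil, List.mem_singleton] at h2
    exact hw.ne h2.symm

theorem IsMaximalGeodesic.reverse {u v : V} {p : T.Walk u v} (hp : IsMaximalGeodesic T p) :
    IsMaximalGeodesic T p.reverse := by
  refine ⟨by rw [IsGeodesic, SimpleGraph.Walk.length_reverse, hp.1, SimpleGraph.dist_comm], ?_⟩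
  intro x y q hq hsub
  rw [SimpleGraph.Walk.length_reverse, ← q.length_reverse]
  apply hp.2
  · rw [IsGeodesic, SimpleGraph.Walk.length_reverse, hq, SimpleGraph.dist_comm]
  · obtain ⟨ru, rv, h⟩ := hsub
    exact ⟨rv.reverse, ru.reverse, by
      rw [h]; simp [SimpleGraph.Walk.reverse_append, SimpleGraph.Walk.append_assoc]⟩

/-- A path cannot be continued through a leaf. -/
theorem nil_of_append_isPath {a b c : V} {p : T.Walk a b} {q : T.Walk b c}
    (hpq : (p.append q).IsPath) (hb : deg (ofGraph T) b = 1) (hp : ¬ p.Nil) : q.Nil := by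
  by_contra hq
  obtain ⟨w, hw⟩ := deg_eq_one_iff.1 hb
  have h1 : p.penultimate ∈ (ofGraph T).neighborSet b := (p.adj_penultimate hp).symm
  have h2 : q.snd ∈ (ofGraph T).neighborSet b := q.adj_snd hq
  rw [hw, Set.mem_singleton_iff] at h1 h2
  refine hpq.ne_of_mem_support_of_append (q.adj_snd hq).ne' (x := p.penultimate) (y := q.snd)
    (p.getVert_mem_support _) (q.getVert_mem_support _) (h1.trans h2.symm)

theorem isMaximalGeodesic_of_leaves (hT : T.IsTree) {u v : V} {p : T.Walk u v} (hp : p.IsPath)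
    (huv : u ≠ v) (hu : deg (ofGraph T) u = 1) (hv : deg (ofGraph T) v = 1) :
    IsMaximalGeodesic T p := by
  refine ⟨isGeodesic_of_isPath hT.isAcyclic hp, ?_⟩
  rintro x y q hq ⟨ru, rv, rfl⟩
  have hqp := SimpleGraph.Walk.isPath_of_length_eq_dist _ hq
  have hpn : ¬ p.Nil := fun h => huv h.eq
  have h1 : rv.Nil := nil_of_append_isPath hqp hv (by
    rw [SimpleGraph.Walk.nil_append_iff]; exact fun h => hpn h.2)
  have h2 : ru.Nil := by
    by_contra h
    exact hpn (nil_of_append_isPath hqp.of_append_left hu h)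
  rw [SimpleGraph.Walk.length_append, SimpleGraph.Walk.length_append,
    SimpleGraph.Walk.length_eq_zero_iff.2 h1, SimpleGraph.Walk.length_eq_zero_iff.2 h2]
  simp

/-- `Avoids G S a b`: a walk of `G` that avoids `S` leads from `a` to `b` (or `a = b`). -/
def Avoids (G : PGraph V) (S : Set V) : V → V → Prop :=
  Relation.ReflTransGen fun x y => G.Adj x y ∧ x ∉ S ∧ y ∉ S

/-- `S` separates the leaves of `G`: no two different leaves are joined by a walk that avoids `S`.
For trees this is the same as being geodesic-transversal, and it makes sense for all the graphs that
occur in the algorithm. -/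
def SeparatesLeaves (G : PGraph V) (S : Set V) : Prop :=
  ∀ a b, deg G a = 1 → deg G b = 1 → Avoids G S a b → a = b

theorem isTransversal_iff [Nontrivial V] (hT : T.IsTree) {S : Set V} :
    IsTransversal T S ↔ SeparatesLeaves (ofGraph T) S := by
  classical
  constructor
  · intro h a b ha hb hab
    by_contra hne
    have key : ∀ c, Avoids (ofGraph T) S a c →
        a = c ∨ ∃ p : T.Walk a c, ∀ x ∈ p.support, x ∉ S := by
      intro c hc
      induction hc with
      | refl => exact Or.inl rfl
      | tail _ hcd ih =>
        right
        have hadj : T.Adj _ _ := hcd.1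
        rcases ih with rfl | ⟨p, hp⟩
        · refine ⟨SimpleGraph.Walk.cons hadj SimpleGraph.Walk.nil, ?_⟩
          simpa using hcd.2
        · refine ⟨p.concat hadj, ?_⟩
          intro x hx
          rw [SimpleGraph.Walk.support_concat, List.mem_append] at hx
          rcases hx with hx | hx
          · exact hp x hx
          · rw [List.mem_singleton] at hx
            exact hx ▸ hcd.2.2
    rcases key b hab with h' | ⟨p, hp⟩
    · exact hne h'
    · obtain ⟨x, hxS, hx⟩ := h a b p.bypass
        (isMaximalGeodesic_of_leaves hT p.bypass_isPath hne ha hb)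
      exact hp x (p.support_bypass_subset_support hx) hxS
  · intro h u v p hp
    by_contra hcon
    push Not at hcon
    have key : ∀ {a b : V} (q : T.Walk a b), (∀ x ∈ q.support, x ∉ S) →
        Avoids (ofGraph T) S a b := by
      intro a b q
      induction q with
      | nil => exact fun _ => Relation.ReflTransGen.refl
      | cons hadj q ih =>
        intro hq
        simp only [SimpleGraph.Walk.support_cons, List.mem_cons, forall_eq_or_imp] at hq
        exact Relation.ReflTransGen.head ⟨hadj, hq.1, hq.2 _ q.start_mem_support⟩ (ih hq.2)
    exact (hp.deg_end hT).2 (h u v (hp.reverse.deg_end hT).1 (hp.deg_end hT).1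
      (key p fun x hx hxS => hcon x hxS hx))

end TreeGeodesics

/-! ### Smoothing -/

section Smoothing

variable {V : Type*} {G G' : PGraph V} {S : Set V} {v : V}

/-- `f` orders the vertices in such a way that every vertex has at most one smaller neighbor. Such
an order exists exactly for forests; it survives deletions and smoothings unchanged. -/
structure IsForestOrder (f : V → ℕ) (G : PGraph V) : Prop where
  injective : Function.Injective f
  unique : ∀ v x y, G.Adj v x → G.Adj v y → f x < f v → f y < f v → x = y

theorem IsForestOrder.not_triangle {f : V → ℕ} (h : IsForestOrder f G) {x y z : V}
    (hxy : G.Adj x y) (hyz : G.Adj y z) (hxz : G.Adj x z) : False := by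
  have h1 := h.unique x y z hxy hxz
  have h2 := h.unique y x z hxy.symm hyz
  have h3 := h.unique z x y hxz.symm hyz.symm
  have n1 := h.injective.ne hxy.ne
  have n2 := h.injective.ne hyz.ne
  have n3 := h.injective.ne hxz.ne
  have m1 := hxy.ne
  have m2 := hyz.ne
  have m3 := hxz.ne
  grind

/-- The invariant of the current graph under smoothing: a forest without isolated vertices. -/
structure IsGoodForest (f : V → ℕ) (G : PGraph V) : Prop where
  order : IsForestOrder f G
  deg_ne_zero : ∀ v ∈ G.verts, deg G v ≠ 0

theorem IsSmoothing.exists_neighbors (h : IsSmoothing G v G') :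
    ∃ x y, x ≠ y ∧ G.Adj v x ∧ G.Adj v y ∧ (∀ b, G.Adj v b → b = x ∨ b = y) ∧
      ∀ a b, G'.Adj a b ↔
        (G.Adj a b ∧ a ≠ v ∧ b ≠ v) ∨ (a = x ∧ b = y) ∨ (a = y ∧ b = x) := by
  obtain ⟨x, y, hxy, hN, -, hadj⟩ := h
  have hNv : ∀ b, G.Adj v b ↔ b = x ∨ b = y := by
    intro b
    rw [← SimpleGraph.Subgraph.mem_neighborSet, hN]
    rfl
  exact ⟨x, y, hxy, (hNv x).2 (Or.inl rfl), (hNv y).2 (Or.inr rfl), fun b => (hNv b).1, hadj⟩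

theorem IsSmoothing.verts_eq (h : IsSmoothing G v G') : G'.verts = G.verts \ {v} := by
  obtain ⟨x, y, -, -, hverts, -⟩ := h
  exact hverts

theorem IsSmoothing.deg_smoothed (h : IsSmoothing G v G') : deg G v = 2 := by
  obtain ⟨x, y, hxy, hN, -, -⟩ := h
  rw [deg, hN, Set.ncard_pair hxy]

theorem IsSmoothing.forestOrder {f : V → ℕ} (hf : IsForestOrder f G) (h : IsSmoothing G v G') :
    IsForestOrder f G' := by
  obtain ⟨x, y, hxy, hx, hy, hNv, hadj⟩ := h.exists_neighbors
  refine ⟨hf.injective, fun w a b ha hb hfa hfb => ?_⟩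
  have u1 := hf.unique
  have n1 := hf.injective.ne hxy
  have n2 := hf.injective.ne hx.ne
  have n3 := hf.injective.ne hy.ne
  have hx' := hx.symm
  have hy' := hy.symm
  rw [hadj] at ha hb
  have q1 := u1 w a b
  have q2 := u1 w a v
  have q3 := u1 w b v
  have q4 := u1 v x y
  rcases ha with ⟨ha, ha1, ha2⟩ | ⟨rfl, rfl⟩ | ⟨rfl, rfl⟩ <;>
  rcases hb with ⟨hb, hb1, hb2⟩ | ⟨hb1, hb2⟩ | ⟨hb1, hb2⟩ <;> grind

theorem IsSmoothing.deg_eq {f : V → ℕ} (hf : IsForestOrder f G) (h : IsSmoothing G v G') {a : V}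
    (ha : a ≠ v) : deg G' a = deg G a := by
  obtain ⟨x, y, hxy, hx, hy, hNv, hadj⟩ := h.exists_neighbors
  have hnxy : ¬ G.Adj x y := fun hc => hf.not_triangle hx hc hy
  have hnyx : ¬ G.Adj y x := fun hc => hnxy hc.symm
  unfold deg
  by_cases hax : a = x
  · subst hax
    have : G'.neighborSet a = insert y (G.neighborSet a \ {v}) := by
      ext b
      simp only [SimpleGraph.Subgraph.mem_neighborSet, hadj, Set.mem_insert_iff, Set.mem_sdiff,
        Set.mem_singleton_iff]
      tauto
    rw [this]
    exact Set.ncard_exchange hnxy hx.symm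
  by_cases hay : a = y
  · subst hay
    have : G'.neighborSet a = insert x (G.neighborSet a \ {v}) := by
      ext b
      simp only [SimpleGraph.Subgraph.mem_neighborSet, hadj, Set.mem_insert_iff, Set.mem_sdiff,
        Set.mem_singleton_iff]
      tauto
    rw [this]
    exact Set.ncard_exchange hnyx hy.symm
  · congr 1
    ext b
    simp only [SimpleGraph.Subgraph.mem_neighborSet, hadj]
    have : G.Adj a b → b ≠ v := by
      rintro hab rfl
      exact (hNv a hab.symm).elim hax hay
    tauto

theorem IsSmoothing.goodForest {f : V → ℕ} (hf : IsGoodForest f G) (h : IsSmoothing G v G') :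
    IsGoodForest f G' := by
  refine ⟨h.forestOrder hf.order, fun a ha => ?_⟩
  rw [h.verts_eq] at ha
  rw [h.deg_eq hf.order ha.2]
  exact hf.deg_ne_zero a ha.1

/-- A walk through the smoothed vertex can use the new edge instead, since its other vertices are on
the walk already. -/
theorem SeparatesLeaves.of_smoothing {f : V → ℕ} (hf : IsForestOrder f G)
    (h : IsSmoothing G v G') (hv : v ∉ S) (hS : SeparatesLeaves G' S) : SeparatesLeaves G S := by
  intro a b ha hb hab
  have hav : a ≠ v := by rintro rfl; rw [h.deg_smoothed] at ha; omega
  have hbv : b ≠ v := by rintro rfl; rw [h.deg_smoothed] at hb; omega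
  refine hS a b (by rw [h.deg_eq hf hav, ha]) (by rw [h.deg_eq hf hbv, hb]) ?_
  obtain ⟨x, y, hxy, hx, hy, hNv, hadj⟩ := h.exists_neighbors
  have key : ∀ c, Avoids G S a c → (c ≠ v → Avoids G' S a c) ∧
      (c = v → (Avoids G' S a x ∧ x ∉ S) ∨ (Avoids G' S a y ∧ y ∉ S)) := by
    intro c hc
    induction hc with
    | refl => exact ⟨fun _ => Relation.ReflTransGen.refl, fun h => absurd h hav⟩
    | @tail c d _ hcd ih =>
      by_cases hcv : c = v
      · subst hcv
        have hdc : d ≠ c := (G.adj_sub hcd.1).ne'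
        refine ⟨fun _ => ?_, fun h => absurd h hdc⟩
        rcases ih.2 rfl with ⟨h1, h2⟩ | ⟨h1, h2⟩ <;> rcases hNv d hcd.1 with rfl | rfl
        · exact h1
        · exact h1.tail ⟨(hadj _ _).2 (by tauto), h2, hcd.2.2⟩
        · exact h1.tail ⟨(hadj _ _).2 (by tauto), h2, hcd.2.2⟩
        · exact h1
      · refine ⟨fun hdv => (ih.1 hcv).tail ⟨(hadj _ _).2 (Or.inl ⟨hcd.1, hcv, hdv⟩), hcd.2⟩, ?_⟩
        rintro rfl
        have := ih.1 hcv
        rcases hNv c hcd.1.symm with rfl | rfl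
        · exact Or.inl ⟨this, hcd.2.1⟩
        · exact Or.inr ⟨this, hcd.2.1⟩
  exact (key b hab).1 hbv

/-- Smoothing does not increase the minimum size of a set that separates the leaves: a smoothed
vertex can be replaced by one of its neighbors. -/
theorem SeparatesLeaves.exists_smoothing [Finite V] {f : V → ℕ} (hf : IsForestOrder f G)
    (h : IsSmoothing G v G') (hS : SeparatesLeaves G S) :
    ∃ S', SeparatesLeaves G' S' ∧ S'.ncard ≤ S.ncard := by
  have hdeg : ∀ a, deg G' a = 1 → a ≠ v → deg G a = 1 := fun a ha hav => by
    rw [← h.deg_eq hf hav, ha]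
  have hverts := h.verts_eq
  obtain ⟨x, y, hxy, hx, hy, hNv, hadj⟩ := h.exists_neighbors
  have hne : ∀ a, deg G' a = 1 → a ≠ v := by
    rintro a ha rfl
    obtain ⟨w, hw⟩ := deg_eq_one_iff.1 ha
    have : G'.Adj a w := by
      have : w ∈ G'.neighborSet a := by rw [hw]; rfl
      exact this
    have := this.fst_mem
    rw [hverts] at this
    exact this.2 rfl
  by_cases hv : v ∈ S
  · refine ⟨insert x (S \ {v}), ?_, ?_⟩
    · intro a b ha hb hab
      refine hS a b (hdeg a ha (hne a ha)) (hdeg b hb (hne b hb))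
        (Relation.ReflTransGen.mono ?_ _ _ hab)
      rintro c d ⟨h1, h2, h3⟩
      simp only [Set.mem_insert_iff, Set.mem_sdiff, Set.mem_singleton_iff, not_or, not_and,
        not_not] at h2 h3
      rw [hadj] at h1
      rcases h1 with ⟨h1, hc, hd⟩ | ⟨h1, -⟩ | ⟨-, h1⟩
      · exact ⟨h1, fun h => hc (h2.2 h), fun h => hd (h3.2 h)⟩
      · exact absurd h1 h2.1
      · exact absurd h1 h3.1
    · have := Set.ncard_insert_le x (S \ {v})
      have := Set.ncard_sdiff_singleton_add_one hv
      omega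
  · refine ⟨S, fun a b ha hb hab => ?_, le_rfl⟩
    refine hS a b (hdeg a ha (hne a ha)) (hdeg b hb (hne b hb)) ?_
    have : ∀ c, Avoids G' S a c → Avoids G S a c := by
      intro c hc
      induction hc with
      | refl => exact Relation.ReflTransGen.refl
      | tail _ hcd ih =>
        obtain ⟨h1, h2, h3⟩ := hcd
        rw [hadj] at h1
        rcases h1 with ⟨h1, hc, hd⟩ | ⟨rfl, rfl⟩ | ⟨rfl, rfl⟩
        · exact ih.tail ⟨h1, h2, h3⟩
        · exact (ih.tail ⟨hx.symm, h2, hv⟩).tail ⟨hy, hv, h3⟩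
        · exact (ih.tail ⟨hy.symm, h2, hv⟩).tail ⟨hx, hv, h3⟩
    exact this b hab

theorem exists_isSmoothing (hv : deg G v = 2) : ∃ G', IsSmoothing G v G' := by
  obtain ⟨x, y, hxy, hN⟩ := Set.ncard_eq_two.1 hv
  have hx : G.Adj v x := by
    have : x ∈ G.neighborSet v := by rw [hN]; simp
    exact this
  have hy : G.Adj v y := by
    have : y ∈ G.neighborSet v := by rw [hN]; simp
    exact this
  refine ⟨{
    verts := G.verts \ {v}
    Adj := fun a b => (G.Adj a b ∧ a ≠ v ∧ b ≠ v) ∨ (a = x ∧ b = y) ∨ (a = y ∧ b = x)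
    adj_sub := ?_
    edge_vert := ?_
    symm := ?_ }, x, y, hxy, hN, rfl, fun a b => Iff.rfl⟩
  · rintro a b (⟨h, -⟩ | ⟨rfl, rfl⟩ | ⟨rfl, rfl⟩)
    · exact h.adj_sub
    · simpa using hxy
    · simpa using hxy.symm
  · rintro a b (⟨h, h1, -⟩ | ⟨rfl, rfl⟩ | ⟨rfl, rfl⟩)
    · exact ⟨h.fst_mem, h1⟩
    · exact ⟨hx.snd_mem, (G.adj_sub hx).ne'⟩
    · exact ⟨hy.snd_mem, (G.adj_sub hy).ne'⟩
  · refine ⟨fun a b => ?_⟩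
    rintro (⟨h, h1, h2⟩ | ⟨rfl, rfl⟩ | ⟨rfl, rfl⟩)
    · exact Or.inl ⟨h.symm, h2, h1⟩
    · exact Or.inr (Or.inr ⟨rfl, rfl⟩)
    · exact Or.inr (Or.inl ⟨rfl, rfl⟩)

theorem mem_verts_of_deg_ne_zero (hv : deg G v ≠ 0) : v ∈ G.verts := by
  obtain ⟨w, hw⟩ := Set.nonempty_of_ncard_ne_zero hv
  have : G.Adj v w := hw
  exact this.fst_mem

theorem IsSmoothing.ncard_verts [Finite V] (h : IsSmoothing G v G') :
    G'.verts.ncard < G.verts.ncard := by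
  have hv : v ∈ G.verts := mem_verts_of_deg_ne_zero (by rw [h.deg_smoothed]; simp)
  obtain ⟨x, y, -, -, hverts, -⟩ := h
  rw [hverts]
  exact Set.ncard_sdiff_singleton_lt_of_mem hv

theorem exists_isSM [Finite V] (G : PGraph V) : ∃ H, IsSM G H := by
  induction hn : G.verts.ncard using Nat.strong_induction_on generalizing G with
  | _ n ih =>
    by_cases h : ∀ v ∈ G.verts, deg G v ≠ 2
    · exact ⟨G, Relation.ReflTransGen.refl, h⟩
    · push Not at h
      obtain ⟨v, -, hv⟩ := h
      obtain ⟨G', hG'⟩ := exists_isSmoothing hv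
      obtain ⟨H, hH⟩ := ih _ (hn ▸ hG'.ncard_verts) G' rfl
      exact ⟨H, Relation.ReflTransGen.head ⟨v, hG'⟩ hH.1, hH.2⟩

theorem IsSM.ncard_verts [Finite V] {H : PGraph V} (h : IsSM G H) :
    H.verts.ncard ≤ G.verts.ncard := by
  obtain ⟨h, -⟩ := h
  induction h with
  | refl => exact le_rfl
  | tail _ hs ih => exact (hs.choose_spec.ncard_verts.le).trans ih

theorem IsSM.goodForest {f : V → ℕ} {H : PGraph V} (hf : IsGoodForest f G) (h : IsSM G H) :
    IsGoodForest f H := by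
  obtain ⟨h, -⟩ := h
  induction h with
  | refl => exact hf
  | tail _ hs ih => exact hs.choose_spec.goodForest ih

theorem IsSM.separates {f : V → ℕ} {H : PGraph V} (hf : IsGoodForest f G) (h : IsSM G H)
    (hSH : S ⊆ H.verts) (hS : SeparatesLeaves H S) : S ⊆ G.verts ∧ SeparatesLeaves G S := by
  obtain ⟨h, -⟩ := h
  induction h using Relation.ReflTransGen.head_induction_on with
  | refl => exact ⟨hSH, hS⟩
  | @head G₁ G₂ hs _ ih =>
    obtain ⟨v, hv⟩ := hs
    obtain ⟨h1, h2⟩ := ih (hv.goodForest hf)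
    rw [hv.verts_eq] at h1
    exact ⟨fun x hx => (h1 hx).1, h2.of_smoothing hf.order hv fun hvS => (h1 hvS).2 rfl⟩

theorem IsSM.exists_separates [Finite V] {f : V → ℕ} {H : PGraph V} (hf : IsGoodForest f G)
    (h : IsSM G H) (hS : SeparatesLeaves G S) :
    ∃ S', SeparatesLeaves H S' ∧ S'.ncard ≤ S.ncard := by
  obtain ⟨h, -⟩ := h
  induction h using Relation.ReflTransGen.head_induction_on generalizing S with
  | refl => exact ⟨S, hS, le_rfl⟩
  | @head G₁ G₂ hs _ ih =>
    obtain ⟨v, hv⟩ := hs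
    obtain ⟨S₁, h1, h2⟩ := hS.exists_smoothing hf.order hv
    obtain ⟨S₂, h3, h4⟩ := ih (hv.goodForest hf) h1
    exact ⟨S₂, h3, h4.trans h2⟩

end Smoothing

/-! ### Deleting an end support vertex and its leaves -/

section Deletion

variable {V : Type*} {G : PGraph V} {S : Set V} {p : V}

/-- The graph left after the deletion of `p` and of all leaves adjacent to `p`. -/
def deleteSupport (G : PGraph V) (p : V) : PGraph V :=
  G.deleteVerts ({p} ∪ leafNeighbors G p)

theorem mem_deleteSupport {a : V} :
    a ∈ (deleteSupport G p).verts ↔ a ∈ G.verts ∧ a ≠ p ∧ a ∉ leafNeighbors G p := by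
  simp [deleteSupport]

theorem deleteSupport_adj {a b : V} : (deleteSupport G p).Adj a b ↔
    (a ≠ p ∧ a ∉ leafNeighbors G p) ∧ (b ≠ p ∧ b ∉ leafNeighbors G p) ∧ G.Adj a b := by
  simp only [deleteSupport, SimpleGraph.Subgraph.deleteVerts_adj, Set.mem_union,
    Set.mem_singleton_iff, not_or]
  constructor
  · tauto
  · rintro ⟨h1, h2, h3⟩
    exact ⟨h3.fst_mem, h1, h3.snd_mem, h2, h3⟩

theorem eq_of_adj_leaf {a b c : V} (ha : deg G a = 1) (hb : G.Adj a b) (hc : G.Adj a c) :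
    b = c := by
  obtain ⟨w, hw⟩ := deg_eq_one_iff.1 ha
  have h1 : b ∈ G.neighborSet a := hb
  have h2 : c ∈ G.neighborSet a := hc
  rw [hw, Set.mem_singleton_iff] at h1 h2
  rw [h1, h2]

theorem neighborSet_deleteSupport {a : V} (ha : a ∈ (deleteSupport G p).verts) :
    (deleteSupport G p).neighborSet a = G.neighborSet a \ {p} := by
  rw [mem_deleteSupport] at ha
  ext b
  simp only [SimpleGraph.Subgraph.mem_neighborSet, deleteSupport_adj, Set.mem_sdiff,
    Set.mem_singleton_iff]
  constructor
  · tauto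
  · rintro ⟨hab, hbp⟩
    exact ⟨ha.2, ⟨hbp, fun hb => ha.2.1 (eq_of_adj_leaf hb.2 hab.symm hb.1.symm)⟩, hab⟩

theorem deg_deleteSupport_of_not_adj {a : V} (ha : a ∈ (deleteSupport G p).verts)
    (hap : ¬ G.Adj a p) : deg (deleteSupport G p) a = deg G a := by
  rw [deg, neighborSet_deleteSupport ha, Set.sdiff_singleton_eq_self]
  · rfl
  · exact hap

/-- A separating set of the smaller graph, together with `p`, is one of the larger graph: a walk
that avoids `p` and joins two different leaves cannot use a deleted leaf. -/
theorem SeparatesLeaves.insert_support (hS : SeparatesLeaves (deleteSupport G p) S) :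
    SeparatesLeaves G (insert p S) := by
  intro a b ha hb hab
  -- a walk that avoids `p` cannot leave a leaf neighbor of `p`
  have stuck : ∀ c d, c ∈ leafNeighbors G p → G.Adj c d → d = p := fun c d hc hcd =>
    eq_of_adj_leaf hc.2 hcd hc.1.symm
  by_cases hal : a ∈ leafNeighbors G p
  · rcases Relation.ReflTransGen.cases_head hab with h | ⟨d, hd, -⟩
    · exact h
    · exact absurd (Or.inl (stuck a d hal hd.1)) hd.2.2
  have key : ∀ c, Avoids G (insert p S) a c →
      a = c ∨ (Avoids (GeodesicTransversal.deleteSupport G p) S a c ∧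
        (a ≠ p ∧ c ≠ p) ∧ (c ∉ leafNeighbors G p ∨ c = a)) := by
    intro c hc
    induction hc with
    | refl => exact Or.inl rfl
    | @tail c d _ hcd ih =>
      right
      obtain ⟨h1, h2, h3⟩ := hcd
      simp only [Set.mem_insert_iff, not_or] at h2 h3
      have hc : c ∉ leafNeighbors G p := fun h => h3.1 (stuck c d h h1)
      have hd : d ∉ leafNeighbors G p := fun h => h2.1 (stuck d c h h1.symm)
      have step : (GeodesicTransversal.deleteSupport G p).Adj c d :=
        deleteSupport_adj.2 ⟨⟨h2.1, hc⟩, ⟨h3.1, hd⟩, h1⟩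
      rcases ih with rfl | ⟨h4, h5, -⟩
      · exact ⟨Relation.ReflTransGen.single ⟨step, h2.2, h3.2⟩, ⟨h2.1, h3.1⟩, Or.inl hd⟩
      · exact ⟨h4.tail ⟨step, h2.2, h3.2⟩, ⟨h5.1, h3.1⟩, Or.inl hd⟩
  rcases key b hab with h | ⟨h, ⟨hap, hbp⟩, hbl⟩
  · exact h
  · have hbl : b ∉ leafNeighbors G p := by
      rcases hbl with h | rfl
      · exact h
      · exact hal
    have aux : ∀ c, deg G c = 1 → c ≠ p → c ∉ leafNeighbors G p →
        deg (GeodesicTransversal.deleteSupport G p) c = 1 := by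
      intro c hc hcp hcl
      rw [deg_deleteSupport_of_not_adj _ (fun h => hcl ⟨h.symm, hc⟩), hc]
      exact mem_deleteSupport.2 ⟨mem_verts_of_deg_ne_zero (by omega), hcp, hcl⟩
    exact hS a b (aux a ha hap hal) (aux b hb hbp hbl) h

variable [Finite V]

theorem deg_deleteSupport_of_adj {a : V} (h2 : ∀ v ∈ G.verts, deg G v ≠ 2)
    (ha : a ∈ (deleteSupport G p).verts) (hap : G.Adj a p) :
    2 ≤ deg (deleteSupport G p) a := by
  have hmem : p ∈ G.neighborSet a := hap
  have e := Set.ncard_sdiff_singleton_add_one hmem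
  rw [deg, neighborSet_deleteSupport ha]
  rw [mem_deleteSupport] at ha
  have h3 := h2 a ha.1
  have h4 : deg G a ≠ 1 := fun h => ha.2.2 ⟨hap.symm, h⟩
  unfold deg at h3 h4
  omega

/-- Deleting `p` and its leaves creates no new leaf. -/
theorem deg_deleteSupport_eq_one {a : V} (h2 : ∀ v ∈ G.verts, deg G v ≠ 2)
    (ha : deg (deleteSupport G p) a = 1) : deg G a = 1 := by
  have hv : a ∈ (deleteSupport G p).verts := mem_verts_of_deg_ne_zero (by omega)
  by_cases hap : G.Adj a p
  · have := deg_deleteSupport_of_adj h2 hv hap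
    omega
  · rw [← ha, deg_deleteSupport_of_not_adj hv hap]

theorem IsGoodForest.deleteSupport {f : V → ℕ} (hf : IsGoodForest f G)
    (h2 : ∀ v ∈ G.verts, deg G v ≠ 2) : IsGoodForest f (deleteSupport G p) := by
  refine ⟨⟨hf.order.injective, fun v x y hx hy => ?_⟩, fun v hv => ?_⟩
  · rw [deleteSupport_adj] at hx hy
    exact hf.order.unique v x y hx.2.2 hy.2.2
  · by_cases hvp : G.Adj v p
    · have := deg_deleteSupport_of_adj h2 hv hvp
      omega
    · rw [deg_deleteSupport_of_not_adj hv hvp]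
      exact hf.deg_ne_zero v (mem_deleteSupport.1 hv).1

/-- Two leaves, one of which is `p` if `p` is itself a leaf, are joined through `p`; so a set that
separates the leaves contains `p` or a leaf adjacent to `p`. -/
theorem SeparatesLeaves.exists_mem_support (h2 : ∀ v ∈ G.verts, deg G v ≠ 2)
    (hp : IsEndSupport G p) (hS : SeparatesLeaves G S) :
    ∃ x ∈ S, x ∈ ({p} ∪ leafNeighbors G p : Set V) := by
  by_contra hcon
  push Not at hcon
  have hpS : p ∉ S := fun h => hcon p h (Or.inl rfl)
  obtain ⟨⟨l, hl⟩, hdeg⟩ := hp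
  have hlS : l ∉ S := fun h => hcon l h (Or.inr hl)
  have hl2 : Avoids G S l p := Relation.ReflTransGen.single ⟨hl.1.symm, hlS, hpS⟩
  by_cases hp1 : deg G p = 1
  · exact (G.adj_sub hl.1).ne (hS l p hl.2 hp1 hl2).symm
  · have hp0 : deg G p ≠ 0 := by
      have : l ∈ G.neighborSet p := hl.1
      exact ((Set.ncard_pos (Set.toFinite _)).2 ⟨l, this⟩).ne'
    have hp2 := h2 p hl.1.fst_mem
    obtain ⟨m, hm, hml⟩ := Set.exists_ne_of_one_lt_ncard (s := leafNeighbors G p)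
      (by omega) l
    have hmS : m ∉ S := fun h => hcon m h (Or.inr hm)
    exact hml (hS l m hl.2 hm.2 (hl2.tail ⟨hm.1, hpS, hmS⟩)).symm

theorem SeparatesLeaves.sdiff_support (h2 : ∀ v ∈ G.verts, deg G v ≠ 2)
    (hS : SeparatesLeaves G S) :
    SeparatesLeaves (GeodesicTransversal.deleteSupport G p) (S \ ({p} ∪ leafNeighbors G p)) := by
  intro a b ha hb hab
  refine hS a b (deg_deleteSupport_eq_one h2 ha) (deg_deleteSupport_eq_one h2 hb)
    (Relation.ReflTransGen.mono ?_ _ _ hab)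
  rintro c d ⟨h1, h3, h4⟩
  rw [deleteSupport_adj] at h1
  refine ⟨h1.2.2, fun h => h3 ⟨h, ?_⟩, fun h => h4 ⟨h, ?_⟩⟩
  · exact fun h => h.elim h1.1.1 h1.1.2
  · exact fun h => h.elim h1.2.1.1 h1.2.1.2

theorem exists_isEndSupport {f : V → ℕ} (hf : IsGoodForest f G)
    (h2 : ∀ v ∈ G.verts, deg G v ≠ 2) (hne : G.verts.Nonempty) : ∃ p, IsEndSupport G p := by
  by_cases hall : ∀ v ∈ G.verts, deg G v = 1
  · obtain ⟨p, hp⟩ := hne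
    obtain ⟨w, hw⟩ := deg_eq_one_iff.1 (hall p hp)
    have hadj : G.Adj p w := by
      have : w ∈ G.neighborSet p := by rw [hw]; rfl
      exact this
    exact ⟨p, ⟨w, hadj, hall w hadj.snd_mem⟩, by rw [hall p hp]; simp⟩
  · push Not at hall
    -- in the forest order, a largest vertex among those that are not leaves
    obtain ⟨p, ⟨hp, hp1⟩, hmax⟩ := Set.exists_max_image {v | v ∈ G.verts ∧ deg G v ≠ 1} f
      (Set.toFinite _) hall
    have hdeg : 3 ≤ deg G p := by
      have := h2 p hp
      have := hf.deg_ne_zero p hp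
      omega
    have hcard : deg G p - 1 ≤ (leafNeighbors G p).ncard := by
      have hsub : (G.neighborSet p \ leafNeighbors G p).ncard ≤ 1 := by
        rw [Set.ncard_le_one]
        rintro a ⟨ha, ha'⟩ b ⟨hb, hb'⟩
        have aux : ∀ c, G.Adj p c → c ∉ leafNeighbors G p → f c < f p := by
          intro c hc hc'
          refine lt_of_le_of_ne (hmax c ⟨hc.snd_mem, fun h => hc' ⟨hc, h⟩⟩) ?_
          exact hf.order.injective.ne (G.adj_sub hc).ne'
        exact hf.order.unique p a b ha hb (aux a ha ha') (aux b hb hb')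
      have hle : leafNeighbors G p ⊆ G.neighborSet p := fun x hx => hx.1
      have := Set.ncard_sdiff_add_ncard_of_subset hle
      unfold deg
      omega
    exact ⟨p, Set.nonempty_of_ncard_ne_zero (by omega), hcard⟩

end Deletion

/-! ### Correctness of the algorithm -/

section Correctness

variable {V : Type*} {T : SimpleGraph V}

/-- What holds at every loop test. The last two fields say that the selected vertices, together with
a minimum separating set of the current graph, form a minimum separating set of the tree. -/
structure LoopInvariant (f : V → ℕ) (T : SimpleGraph V) (c : Config V) : Prop where
  forest : IsGoodForest f c.graph
  deg_ne_two : ∀ v ∈ c.graph.verts, deg c.graph v ≠ 2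
  extend : ∀ S ⊆ c.graph.verts, SeparatesLeaves c.graph S →
    SeparatesLeaves (ofGraph T) ({v | v ∈ c.chosen} ∪ S)
  restrict : ∀ S, SeparatesLeaves (ofGraph T) S →
    ∃ S', SeparatesLeaves c.graph S' ∧ c.chosen.length + S'.ncard ≤ S.ncard

theorem LoopInvariant.isGtSet [Nontrivial V] (hT : T.IsTree) {f : V → ℕ} {c : Config V}
    (hc : LoopInvariant f T c) (hempty : c.graph.verts = ∅) : IsGtSet T {v | v ∈ c.chosen} := by
  classical
  have hsep : SeparatesLeaves c.graph ∅ := by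
    intro a b ha
    have : a ∈ c.graph.verts := mem_verts_of_deg_ne_zero (by omega)
    rw [hempty] at this
    exact this.elim
  refine ⟨(isTransversal_iff hT).2 (by simpa using hc.extend ∅ (Set.empty_subset _) hsep), ?_⟩
  intro S' hS'
  obtain ⟨S'', -, h⟩ := hc.restrict S' ((isTransversal_iff hT).1 hS')
  have : {v | v ∈ c.chosen}.ncard ≤ c.chosen.length := by
    rw [← List.coe_toFinset, Set.ncard_coe_finset]
    exact c.chosen.toFinset_card_le
  omega

variable [Finite V]

theorem LoopStep.ncard_verts {c c' : Config V} (h : LoopStep c c') :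
    c'.graph.verts.ncard < c.graph.verts.ncard := by
  obtain ⟨-, p, hp, -, hSM⟩ := h
  refine hSM.ncard_verts.trans_lt (Set.ncard_lt_ncard ?_)
  obtain ⟨l, hl⟩ := hp.1
  have hp : p ∈ c.graph.verts := hl.1.fst_mem
  refine Set.ssubset_iff_subset_ne.2 ⟨fun x hx => (mem_deleteSupport.1 hx).1, fun h => ?_⟩
  rw [← h] at hp
  exact (mem_deleteSupport.1 hp).2.1 rfl

theorem LoopInvariant.start {f : V → ℕ} {c : Config V} (hf : IsGoodForest f (ofGraph T))
    (hc : IsStart T c) : LoopInvariant f T c := by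
  obtain ⟨hSM, hnil⟩ := hc
  refine ⟨hSM.goodForest hf, hSM.2, fun S hS hsep => ?_, fun S hS => ?_⟩
  · have := (hSM.separates hf hS hsep).2
    simpa [hnil] using this
  · simpa [hnil] using hSM.exists_separates hf hS

theorem LoopInvariant.step {f : V → ℕ} {c c' : Config V} (hc : LoopInvariant f T c)
    (h : LoopStep c c') : LoopInvariant f T c' := by
  obtain ⟨-, p, hp, hch, hSM⟩ := h
  change IsSM (deleteSupport c.graph p) c'.graph at hSM
  have hgood := hc.forest.deleteSupport (p := p) hc.deg_ne_two
  refine ⟨hSM.goodForest hgood, hSM.2, fun S hS hsep => ?_, fun S hS => ?_⟩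
  · obtain ⟨h1, h2⟩ := hSM.separates hgood hS hsep
    have hpv : p ∈ c.graph.verts := by
      obtain ⟨l, hl⟩ := hp.1
      exact hl.1.fst_mem
    have := hc.extend (insert p S) (Set.insert_subset hpv fun x hx =>
      (mem_deleteSupport.1 (h1 hx)).1) h2.insert_support
    convert this using 1
    ext x
    simp only [hch, List.mem_append, List.mem_singleton, Set.mem_union, Set.mem_ofPred_eq,
      Set.mem_insert_iff]
    tauto
  · obtain ⟨S₁, h1, h2⟩ := hc.restrict S hS
    obtain ⟨x, hx, hxp⟩ := h1.exists_mem_support hc.deg_ne_two hp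
    obtain ⟨S₂, h3, h4⟩ := hSM.exists_separates hgood (h1.sdiff_support hc.deg_ne_two)
    refine ⟨S₂, h3, ?_⟩
    have : (S₁ \ ({p} ∪ leafNeighbors c.graph p)).ncard < S₁.ncard := by
      refine Set.ncard_lt_ncard (Set.ssubset_iff_subset_ne.2 ⟨Set.sdiff_subset, fun h => ?_⟩)
      rw [← h] at hx
      exact hx.2 hxp
    rw [hch, List.length_append, List.length_singleton]
    omega

theorem exists_goodForest [Nontrivial V] (hT : T.IsTree) :
    ∃ f : V → ℕ, IsGoodForest f (ofGraph T) := by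
  obtain ⟨r⟩ := hT.connected.nonempty
  have e := Finite.equivFin V
  -- by distance from `r`, ties broken by an arbitrary enumeration
  refine ⟨fun v => T.dist r v * Nat.card V + e v, ⟨⟨?_, ?_⟩, ?_⟩⟩
  · intro x y hxy
    have hmod := congrArg (· % Nat.card V) hxy
    simp only [Nat.mul_add_mod_self_right, Nat.mod_eq_of_lt (e _).2] at hmod
    exact e.injective (Fin.ext hmod)
  · have aux : ∀ v x, T.Adj v x →
        T.dist r x * Nat.card V + e x < T.dist r v * Nat.card V + e v →
        T.dist r x < T.dist r v := by
      intro v x hvx hlt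
      refine lt_of_le_of_ne ?_ (hT.dist_ne_of_adj r hvx).symm
      by_contra hcon
      have := Nat.mul_le_mul_right (Nat.card V) (Nat.succ_le_of_lt (not_le.1 hcon))
      have := (e v).2
      rw [Nat.succ_mul] at *
      omega
    intro v x y hx hy hfx hfy
    exact eq_of_dist_lt hT hx hy (aux v x hx hfx) (aux v y hy hfy)
  · intro v _
    obtain ⟨w, hw⟩ := hT.connected.preconnected.exists_adj_of_nontrivial v
    exact ((Set.ncard_pos (Set.toFinite _)).2 ⟨w, hw⟩).ne'

theorem loopInvariant_of_reachable {f : V → ℕ} {c : Config V} (hf : IsGoodForest f (ofGraph T))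
    (hc : Reachable T c) : LoopInvariant f T c := by
  obtain ⟨c₀, h0, h⟩ := hc
  induction h with
  | refl => exact LoopInvariant.start hf h0
  | tail _ hs ih => exact ih.step hs

theorem acc_loopStep (c : Config V) : Acc (fun c₂ c₁ : Config V => LoopStep c₁ c₂) c := by
  induction hn : c.graph.verts.ncard using Nat.strong_induction_on generalizing c with
  | _ n ih => exact Acc.intro c fun c' h => ih _ (hn ▸ h.ncard_verts) c' rfl

theorem algorithm_correct (hT : T.IsTree) (hcard : 2 ≤ Nat.card V) :
    (∃ c₀ : Config V, IsStart T c₀) ∧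
    ∀ c : Config V, Reachable T c →
      Acc (fun c₂ c₁ : Config V => LoopStep c₁ c₂) c ∧
      (c.graph.verts.Nonempty → ∃ c' : Config V, LoopStep c c') ∧
      (c.graph.verts = ∅ → IsGtSet T {v | v ∈ c.chosen}) := by
  have : Nontrivial V := Finite.one_lt_card_iff_nontrivial.1 hcard
  obtain ⟨f, hf⟩ := exists_goodForest hT
  constructor
  · obtain ⟨H, hH⟩ := exists_isSM (ofGraph T)
    exact ⟨⟨H, []⟩, hH, rfl⟩
  · intro c hc
    have hinv := loopInvariant_of_reachable hf hc
    refine ⟨acc_loopStep c, fun hne => ?_, hinv.isGtSet hT⟩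
    obtain ⟨p, hp⟩ := exists_isEndSupport hinv.forest hinv.deg_ne_two hne
    obtain ⟨H, hH⟩ := exists_isSM (deleteSupport c.graph p)
    exact ⟨⟨H, c.chosen ++ [p]⟩, hne, p, hp, rfl, hH⟩

end Correctness

/-! ### Hasse diagrams of tree orders -/

section Hasse

variable {V : Type*}

/-- A rooted-tree order: the elements below any given element form a chain, and there is a least
element. The depth is only used to pick minimal and maximal elements. -/
structure TreeOrder (V : Type*) where
  le : V → V → Prop
  depth : V → ℕ
  root : V
  refl : ∀ a, le a a
  trans : ∀ a b c, le a b → le b c → le a c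
  root_le : ∀ a, le root a
  depth_lt : ∀ a b, le a b → a ≠ b → depth a < depth b
  chain : ∀ a b c, le a c → le b c → le a b ∨ le b a

namespace TreeOrder

variable (O : TreeOrder V) {X Y L : Set V}

/-- The strict part of the order. -/
def lt (a b : V) : Prop := O.le a b ∧ a ≠ b

/-- `b` is an upper cover of `a` in the suborder on `X`. -/
def Covers (X : Set V) (a b : V) : Prop :=
  a ∈ X ∧ b ∈ X ∧ O.lt a b ∧ ∀ z ∈ X, O.lt a z → ¬ O.lt z b

/-- The Hasse diagram of the suborder on `X`. -/
def hasse (X : Set V) : PGraph V where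
  verts := X
  Adj a b := O.Covers X a b ∨ O.Covers X b a
  adj_sub := by
    rintro a b (h | h)
    · exact h.2.2.1.2
    · exact h.2.2.1.2.symm
  edge_vert := by
    rintro a b (h | h)
    · exact h.1
    · exact h.2.1
  symm := ⟨fun _ _ h => h.symm⟩

/-- `v` lies strictly below `a` and `b`, and nothing above `v` lies below both of them: `v` is the
last common ancestor of `a` and `b`, which are not comparable. -/
def IsMeet (v a b : V) : Prop :=
  O.lt v a ∧ O.lt v b ∧ ∀ z, O.lt v z → O.le z a → ¬ O.le z b

/-- The elements of `L` and their pairwise meets. -/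
def span (L : Set V) : Set V :=
  {v | v ∈ L ∨ ∃ a ∈ L, ∃ b ∈ L, O.IsMeet v a b}

variable {O}

theorem antisymm {a b : V} (h1 : O.le a b) (h2 : O.le b a) : a = b := by
  by_contra hne
  have := O.depth_lt a b h1 hne
  have := O.depth_lt b a h2 (Ne.symm hne)
  omega

theorem lt_of_lt_of_le {a b c : V} (h1 : O.lt a b) (h2 : O.le b c) : O.lt a c :=
  ⟨O.trans _ _ _ h1.1 h2, by rintro rfl; exact h1.2 (antisymm h1.1 h2)⟩

theorem not_lt_self {a : V} : ¬ O.lt a a := fun h => h.2 rfl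

theorem root_lt {a : V} (h : a ≠ O.root) : O.lt O.root a := ⟨O.root_le a, h.symm⟩

theorem ne_root_of_lt {a b : V} (h : O.lt a b) : b ≠ O.root := by
  rintro rfl
  exact h.2 (antisymm h.1 (O.root_le a))

theorem le_or_lt {a b c : V} (ha : O.le a c) (hb : O.le b c) : O.le a b ∨ O.lt b a := by
  by_cases h : b = a
  · exact Or.inl (h ▸ O.refl b)
  · exact (O.chain a b c ha hb).imp_right fun h' => ⟨h', h⟩

theorem Covers.lower_unique {a b c : V} (ha : O.Covers X a c) (hb : O.Covers X b c) : a = b := by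
  by_contra hne
  rcases O.chain a b c ha.2.2.1.1 hb.2.2.1.1 with h | h
  · exact ha.2.2.2 b hb.1 ⟨h, hne⟩ hb.2.2.1
  · exact hb.2.2.2 a ha.1 ⟨h, Ne.symm hne⟩ ha.2.2.1

theorem Covers.upper_unique_of_le {a b c d : V} (hb : O.Covers X a b) (hc : O.Covers X a c)
    (hbd : O.le b d) (hcd : O.le c d) : b = c := by
  by_contra hne
  rcases O.chain b c d hbd hcd with h | h
  · exact hc.2.2.2 b hb.2.1 hb.2.2.1 ⟨h, hne⟩
  · exact hb.2.2.2 c hc.2.1 hc.2.2.1 ⟨h, Ne.symm hne⟩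

theorem Covers.le_of_lt {a b c d : V} (h : O.Covers X a b) (hc : c ∈ X) (hac : O.lt a c)
    (hb : O.le b d) (hcd : O.le c d) : O.le b c :=
  (le_or_lt hb hcd).resolve_right fun h' => h.2.2.2 c hc hac h'

theorem span_mono {L L' : Set V} (h : L ⊆ L') : O.span L ⊆ O.span L' := by
  rintro v (hv | ⟨a, ha, b, hb, hm⟩)
  · exact Or.inl (h hv)
  · exact Or.inr ⟨a, h ha, b, h hb, hm⟩

/-- A set of leaves of a tree whose root is itself a leaf: the root belongs to the set, the other
elements are maximal, and the root does not branch. -/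
structure IsLeafSet (O : TreeOrder V) (L : Set V) : Prop where
  root_mem : O.root ∈ L
  maximal : ∀ a ∈ L, a ≠ O.root → ∀ z, ¬ O.lt a z
  root_not_meet : ∀ a b, ¬ O.IsMeet O.root a b

theorem IsLeafSet.not_lt_of_mem (hL : O.IsLeafSet L) {v a z : V} (ha : a ∈ L) (hva : O.lt v a) :
    ¬ O.lt a z :=
  hL.maximal a ha (ne_root_of_lt hva) z

theorem exists_le_of_mem_span {x : V} (hx : x ∈ O.span L) :
    ∃ a ∈ L, O.le x a := by
  rcases hx with hx | ⟨a, ha, _, _, hm⟩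
  · exact ⟨x, hx, O.refl x⟩
  · exact ⟨a, ha, hm.1.1⟩

/-- An element with exactly one lower and one upper cover has degree two in the Hasse diagram, and
smoothing it gives the Hasse diagram of the remaining set. -/
theorem isSmoothing_hasse {u v c : V} (hu : O.Covers X u v) (hc : O.Covers X v c)
    (huniq : ∀ d, O.Covers X v d → d = c) :
    IsSmoothing (O.hasse X) v (O.hasse (X \ {v})) := by
  have huc : O.lt u c := lt_of_lt_of_le hu.2.2.1 hc.2.2.1.1
  have hnew : O.Covers (X \ {v}) u c := by
    refine ⟨⟨hu.1, hu.2.2.1.2⟩, ⟨hc.2.1, hc.2.2.1.2.symm⟩, huc, fun z hz huz hzc => ?_⟩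
    rcases le_or_lt hzc.1 hc.2.2.1.1 with h | h
    · exact hu.2.2.2 z hz.1 huz ⟨h, hz.2⟩
    · exact hc.2.2.2 z hz.1 h hzc
  have key : ∀ a b, O.Covers (X \ {v}) a b ↔
      (O.Covers X a b ∧ a ≠ v ∧ b ≠ v) ∨ (a = u ∧ b = c) := by
    intro a b
    constructor
    · intro h
      by_cases hab : O.Covers X a b
      · exact Or.inl ⟨hab, h.1.2, h.2.1.2⟩
      · right
        have hbetw : O.lt a v ∧ O.lt v b := by
          by_contra hcon
          refine hab ⟨h.1.1, h.2.1.1, h.2.2.1, fun z hz haz hzb => ?_⟩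
          by_cases hzv : z = v
          · subst hzv
            exact hcon ⟨haz, hzb⟩
          · exact h.2.2.2 z ⟨hz, hzv⟩ haz hzb
        have hav : O.Covers X a v := ⟨h.1.1, hu.2.1, hbetw.1, fun z hz haz hzv =>
          h.2.2.2 z ⟨hz, hzv.2⟩ haz (lt_of_lt_of_le hzv hbetw.2.1)⟩
        have hvb : O.Covers X v b := ⟨hu.2.1, h.2.1.1, hbetw.2, fun z hz hvz hzb =>
          h.2.2.2 z ⟨hz, hvz.2.symm⟩ (lt_of_lt_of_le hbetw.1 hvz.1) hzb⟩
        exact ⟨hav.lower_unique hu, huniq b hvb⟩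
    · rintro (⟨h, ha, hb⟩ | ⟨rfl, rfl⟩)
      · exact ⟨⟨h.1, ha⟩, ⟨h.2.1, hb⟩, h.2.2.1, fun z hz => h.2.2.2 z hz.1⟩
      · exact hnew
  refine ⟨u, c, huc.2, ?_, rfl, fun a b => ?_⟩
  · ext z
    simp only [SimpleGraph.Subgraph.mem_neighborSet, hasse, Set.mem_insert_iff,
      Set.mem_singleton_iff]
    constructor
    · rintro (h | h)
      · exact Or.inr (huniq z h)
      · exact Or.inl (h.lower_unique hu)
    · rintro (rfl | rfl)
      · exact Or.inr hu
      · exact Or.inl hc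
  · change O.Covers (X \ {v}) a b ∨ O.Covers (X \ {v}) b a ↔
      ((O.Covers X a b ∨ O.Covers X b a) ∧ a ≠ v ∧ b ≠ v) ∨ _
    rw [key, key]
    tauto

theorem mem_of_mem_span_of_lt {v x : V}
    (hv : ∀ z, O.lt v z → ∀ a ∈ L, ∀ b ∈ L, O.le z a → O.le z b → a = b)
    (hx : x ∈ O.span L) (hvx : O.lt v x) : x ∈ L := by
  rcases hx with hx | ⟨a, ha, b, hb, hm⟩
  · exact hx
  · have := hv x hvx a ha b hb hm.1.1 hm.2.1.1
    subst this
    exact absurd (O.refl a) (hm.2.2 a hm.1 (O.refl a))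

/-- An element of the span that is not above `v` lies below some leaf that is not above `v`: if both
leaves of a meet are above `v`, so is the meet. -/
theorem exists_not_le_of_mem_span {v x : V}
    (hx : x ∈ O.span L) (hvx : ¬ O.le v x) : ∃ a ∈ L, O.le x a ∧ ¬ O.le v a := by
  rcases hx with hx | ⟨a, ha, b, hb, hm⟩
  · exact ⟨x, hx, O.refl x, hvx⟩
  · by_cases hva : O.le v a
    · refine ⟨b, hb, hm.2.1.1, fun hvb => ?_⟩
      have hxv : O.lt x v := (le_or_lt hva hm.1.1).resolve_left hvx
      exact hm.2.2 v hxv hva hvb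
    · exact ⟨a, ha, hm.1.1, hva⟩

theorem IsLeafSet.sdiff (hL : O.IsLeafSet L) {v : V} (hv0 : v ≠ O.root) :
    O.IsLeafSet (L \ {x | O.le v x}) := by
  refine ⟨⟨hL.root_mem, fun h => hv0 (antisymm h (O.root_le v))⟩, fun a ha => hL.maximal a ha.1,
    hL.root_not_meet⟩

variable [Finite V]

theorem exists_covers_above {a b : V} (ha : a ∈ X) (hb : b ∈ X) (hab : O.lt a b) :
    ∃ c, O.Covers X a c ∧ O.le c b := by
  obtain ⟨c, ⟨h1, h2, h3⟩, hmin⟩ := Set.exists_min_image {z | z ∈ X ∧ O.lt a z ∧ O.le z b} O.depth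
    (Set.toFinite _) ⟨b, hb, hab, O.refl b⟩
  refine ⟨c, ⟨ha, h1, h2, fun z hz haz hzc => ?_⟩, h3⟩
  have := hmin z ⟨hz, haz, O.trans _ _ _ hzc.1 h3⟩
  have := O.depth_lt z c hzc.1 hzc.2
  omega

theorem exists_covers_below {a b : V} (ha : a ∈ X) (hb : b ∈ X) (hab : O.lt a b) :
    ∃ c, O.Covers X c b ∧ O.le a c := by
  obtain ⟨c, ⟨h1, h2, h3⟩, hmax⟩ := Set.exists_max_image {z | z ∈ X ∧ O.le a z ∧ O.lt z b} O.depth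
    (Set.toFinite _) ⟨a, ha, O.refl a, hab⟩
  refine ⟨c, ⟨h1, hb, h3, fun z hz hcz hzb => ?_⟩, h2⟩
  have := hmax z ⟨hz, O.trans _ _ _ h2 hcz.1, hzb⟩
  have := O.depth_lt c z hcz.1 hcz.2
  omega

theorem exists_isMeet {a b : V} (h1 : ¬ O.le a b) (h2 : ¬ O.le b a) : ∃ m, O.IsMeet m a b := by
  obtain ⟨m, ⟨hm1, hm2⟩, hmax⟩ := Set.exists_max_image {z | O.le z a ∧ O.le z b} O.depth
    (Set.toFinite _) ⟨O.root, O.root_le a, O.root_le b⟩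
  refine ⟨m, ⟨hm1, by rintro rfl; exact h1 hm2⟩, ⟨hm2, by rintro rfl; exact h2 hm1⟩, ?_⟩
  intro z hz hza hzb
  have := hmax z ⟨hza, hzb⟩
  have := O.depth_lt m z hz.1 hz.2
  omega

/-- Two different leaves other than the root have a meet. -/
theorem IsLeafSet.exists_isMeet (hL : O.IsLeafSet L) {a b : V} (ha : a ∈ L) (hb : b ∈ L)
    (ha0 : a ≠ O.root) (hb0 : b ≠ O.root) (hab : a ≠ b) : ∃ m, O.IsMeet m a b ∧ m ≠ O.root := by
  obtain ⟨m, hm⟩ := TreeOrder.exists_isMeet (O := O) (a := a) (b := b)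
    (fun h => hL.maximal a ha ha0 b ⟨h, hab⟩) (fun h => hL.maximal b hb hb0 a ⟨h, hab.symm⟩)
  exact ⟨m, hm, by rintro rfl; exact hL.root_not_meet a b hm⟩

/-- In a set that contains the span of `L` and lies below `L`, an element that is no meet of
elements of `L` has at most one upper cover. -/
theorem IsLeafSet.upper_unique (hL : O.IsLeafSet L) (hLY : O.span L ⊆ Y)
    (hY : ∀ y ∈ Y, ∃ a ∈ L, O.le y a) {v c d : V} (hv : ∀ a ∈ L, ∀ b ∈ L, ¬ O.IsMeet v a b)
    (hc : O.Covers Y v c) (hd : O.Covers Y v d) : c = d := by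
  obtain ⟨a, ha, hca⟩ := hY c hc.2.1
  obtain ⟨b, hb, hdb⟩ := hY d hd.2.1
  by_cases hab : a = b
  · subst hab
    exact hc.upper_unique_of_le hd hca hdb
  have hva := lt_of_lt_of_le hc.2.2.1 hca
  have hvb := lt_of_lt_of_le hd.2.2.1 hdb
  obtain ⟨m, hm, -⟩ := hL.exists_isMeet ha hb (ne_root_of_lt hva) (ne_root_of_lt hvb) hab
  have hmY : m ∈ Y := hLY (Or.inr ⟨a, ha, b, hb, hm⟩)
  -- the meet `m` lies strictly above `v`, hence above both covers
  have hvm : O.lt v m := by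
    refine (le_or_lt hm.1.1 hva.1).resolve_left fun hmv => ?_
    by_cases h : m = v
    · subst h
      exact hv a ha b hb hm
    · exact hm.2.2 v ⟨hmv, h⟩ hva.1 hvb.1
  exact hc.upper_unique_of_le hd (hc.le_of_lt hmY hvm hca hm.1.1)
    (hd.le_of_lt hmY hvm hdb hm.2.1.1)

/-- A set between the span of `L` and the elements below `L` can be smoothed down to the span: an
element outside of the span has exactly one upper cover. -/
theorem IsLeafSet.smoothings (hL : O.IsLeafSet L) (hLY : O.span L ⊆ Y)
    (hY : ∀ y ∈ Y, ∃ a ∈ L, O.le y a) :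
    Relation.ReflTransGen (fun G₁ G₂ => ∃ v, IsSmoothing G₁ v G₂) (O.hasse Y)
      (O.hasse (O.span L)) := by
  induction hn : Y.ncard using Nat.strong_induction_on generalizing Y with
  | _ n ih =>
    by_cases h : Y ⊆ O.span L
    · rw [Set.Subset.antisymm h hLY]
    obtain ⟨v, hv, hvL⟩ := Set.not_subset.1 h
    obtain ⟨a, ha, hva⟩ := hY v hv
    have hav : v ≠ a := by
      rintro rfl
      exact hvL (Or.inl ha)
    have hv0 : v ≠ O.root := by
      rintro rfl
      exact hvL (Or.inl hL.root_mem)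
    obtain ⟨c, hc, -⟩ := exists_covers_above hv (hLY (Or.inl ha)) ⟨hva, hav⟩
    obtain ⟨u, hu, -⟩ := exists_covers_below (hLY (Or.inl hL.root_mem)) hv (root_lt hv0)
    have hmeet : ∀ a ∈ L, ∀ b ∈ L, ¬ O.IsMeet v a b := fun a ha b hb hm =>
      hvL (Or.inr ⟨a, ha, b, hb, hm⟩)
    refine Relation.ReflTransGen.head ⟨v, isSmoothing_hasse hu hc fun d hd =>
      hL.upper_unique hLY hY hmeet hd hc⟩ ?_
    refine ih _ (hn ▸ Set.ncard_sdiff_singleton_lt_of_mem hv) ?_ ?_ rfl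
    · intro x hx
      exact ⟨hLY hx, by rintro rfl; exact hvL hx⟩
    · exact fun y hy => hY y hy.1

theorem IsLeafSet.deg_hasse_of_ne_root (hL : O.IsLeafSet L) {a : V} (ha : a ∈ L)
    (ha0 : a ≠ O.root) : deg (O.hasse (O.span L)) a = 1 := by
  obtain ⟨u, hu, -⟩ := exists_covers_below (X := O.span L) (Or.inl hL.root_mem) (Or.inl ha)
    (root_lt ha0)
  refine deg_eq_one_iff.2 ⟨u, Set.eq_singleton_iff_unique_mem.2 ⟨Or.inr hu, ?_⟩⟩
  rintro x (hx | hx)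
  · exact absurd hx.2.2.1 (hL.maximal a ha ha0 x)
  · exact hx.lower_unique hu

theorem IsLeafSet.deg_hasse_root (hL : O.IsLeafSet L) (hne : L ≠ {O.root}) :
    deg (O.hasse (O.span L)) O.root = 1 := by
  obtain ⟨a, ha, ha0⟩ : ∃ a ∈ L, a ≠ O.root := by
    by_contra hcon
    push Not at hcon
    exact hne (Set.eq_singleton_iff_unique_mem.2 ⟨hL.root_mem, hcon⟩)
  obtain ⟨c, hc, -⟩ := exists_covers_above (X := O.span L) (Or.inl hL.root_mem) (Or.inl ha)
    (root_lt ha0)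
  refine deg_eq_one_iff.2 ⟨c, Set.eq_singleton_iff_unique_mem.2 ⟨Or.inl hc, ?_⟩⟩
  rintro x (hx | hx)
  · exact hL.upper_unique (Set.Subset.refl _) (fun y hy => exists_le_of_mem_span hy)
      (fun a _ b _ => hL.root_not_meet a b) hx hc
  · exact absurd rfl (ne_root_of_lt hx.2.2.1)

theorem IsLeafSet.deg_hasse_ne_two (hL : O.IsLeafSet L) (hne : L ≠ {O.root}) :
    ∀ v ∈ (O.hasse (O.span L)).verts, deg (O.hasse (O.span L)) v ≠ 2 := by
  intro v hvX
  by_cases hv0 : v = O.root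
  · rw [hv0, hL.deg_hasse_root hne]
    simp
  rcases id hvX with hv | ⟨a, ha, b, hb, hm⟩
  · rw [hL.deg_hasse_of_ne_root hv hv0]
    simp
  · obtain ⟨c, hc, hca⟩ := exists_covers_above (X := O.span L) hvX (Or.inl ha) hm.1
    obtain ⟨d, hd, hdb⟩ := exists_covers_above (X := O.span L) hvX (Or.inl hb) hm.2.1
    obtain ⟨u, hu, -⟩ := exists_covers_below (X := O.span L) (Or.inl hL.root_mem) hvX (root_lt hv0)
    have hcd : c ≠ d := by
      rintro rfl
      exact hm.2.2 c hc.2.2.1 hca hdb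
    have huc : u ≠ c := by
      rintro rfl
      exact hu.2.2.1.2 (antisymm hu.2.2.1.1 hc.2.2.1.1)
    have hud : u ≠ d := by
      rintro rfl
      exact hu.2.2.1.2 (antisymm hu.2.2.1.1 hd.2.2.1.1)
    have hsub : ({u, c, d} : Set V) ⊆ (O.hasse (O.span L)).neighborSet v := by
      rintro x (rfl | rfl | rfl)
      · exact Or.inr hu
      · exact Or.inl hc
      · exact Or.inl hd
    have h3 : ({u, c, d} : Set V).ncard = 3 := Set.ncard_eq_three.2 ⟨u, c, d, huc, hud, hcd, rfl⟩
    have := Set.ncard_le_ncard hsub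
    unfold deg
    omega

/-- An element `v` with at least two leaves above it, no two of them above the same upper cover, is
an end support vertex of the Hasse diagram. -/
theorem IsLeafSet.isEndSupport (hL : O.IsLeafSet L) {v a b : V} (hv0 : v ≠ O.root)
    (hv : ∀ z, O.lt v z → ∀ a ∈ L, ∀ b ∈ L, O.le z a → O.le z b → a = b)
    (ha : a ∈ L) (hb : b ∈ L) (hab : a ≠ b) (hva : O.le v a) (hvb : O.le v b) :
    v ∈ O.span L ∧ (∀ x ∈ O.span L, O.lt v x → x ∈ leafNeighbors (O.hasse (O.span L)) v) ∧
      IsEndSupport (O.hasse (O.span L)) v := by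
  have hva' : O.lt v a := by
    refine ⟨hva, ?_⟩
    rintro rfl
    exact hL.maximal v ha hv0 b ⟨hvb, hab⟩
  have hvb' : O.lt v b := by
    refine ⟨hvb, ?_⟩
    rintro rfl
    exact hL.maximal v hb hv0 a ⟨hva, hab.symm⟩
  have hvX : v ∈ O.span L :=
    Or.inr ⟨a, ha, b, hb, hva', hvb', fun z hz hza hzb => hab (hv z hz a ha b hb hza hzb)⟩
  have hup : ∀ x ∈ O.span L, O.lt v x → x ∈ leafNeighbors (O.hasse (O.span L)) v := by
    intro x hx hvx
    have hxL := mem_of_mem_span_of_lt hv hx hvx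
    refine ⟨Or.inl ⟨hvX, hx, hvx, fun z hz hvz hzx => ?_⟩,
      hL.deg_hasse_of_ne_root hxL (ne_root_of_lt hvx)⟩
    exact hL.not_lt_of_mem (mem_of_mem_span_of_lt hv hz hvz) hvz hzx
  refine ⟨hvX, hup, ⟨a, hup a (Or.inl ha) hva'⟩, ?_⟩
  -- the only neighbor that need not be a leaf is the lower cover
  have hsub : ((O.hasse (O.span L)).neighborSet v \
      leafNeighbors (O.hasse (O.span L)) v).ncard ≤ 1 := by
    rw [Set.ncard_le_one]
    have aux : ∀ x, x ∈ (O.hasse (O.span L)).neighborSet v \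
        leafNeighbors (O.hasse (O.span L)) v → O.Covers (O.span L) x v := by
      rintro x ⟨hx | hx, hx'⟩
      · exact absurd (hup x hx.2.1 hx.2.2.1) hx'
      · exact hx
    exact fun x hx y hy => (aux x hx).lower_unique (aux y hy)
  have hle : leafNeighbors (O.hasse (O.span L)) v ⊆ (O.hasse (O.span L)).neighborSet v :=
    fun x hx => hx.1
  have := Set.ncard_sdiff_add_ncard_of_subset hle
  unfold deg
  omega

/-- If all leaves but the root lie above `v`, then the Hasse diagram is a star with center `v`. -/
theorem IsLeafSet.deleteSupport_eq_empty (hL : O.IsLeafSet L) {v a b : V} (hv0 : v ≠ O.root)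
    (hv : ∀ z, O.lt v z → ∀ a ∈ L, ∀ b ∈ L, O.le z a → O.le z b → a = b)
    (ha : a ∈ L) (hb : b ∈ L) (hab : a ≠ b) (hva : O.le v a) (hvb : O.le v b)
    (hL' : L \ {x | O.le v x} = {O.root}) :
    (deleteSupport (O.hasse (O.span L)) v).verts = ∅ := by
  obtain ⟨hvX, hup, -⟩ := hL.isEndSupport hv0 hv ha hb hab hva hvb
  have hLv : ∀ x ∈ L, x ≠ O.root → O.le v x := by
    intro x hx hx0
    by_contra hvx
    have : x ∈ L \ {x | O.le v x} := ⟨hx, hvx⟩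
    rw [hL'] at this
    exact hx0 this
  have hle : ∀ x ∈ O.span L, x ≠ O.root → O.le v x := by
    intro x hx hx0
    by_contra hvx
    obtain ⟨c, hc, hxc, hvc⟩ := exists_not_le_of_mem_span hx hvx
    refine hvc (hLv c hc ?_)
    rintro rfl
    exact hx0 (antisymm hxc (O.root_le x))
  have hne : L ≠ {O.root} := by
    intro h
    rw [h] at ha hb
    exact hab (ha.trans hb.symm)
  refine Set.eq_empty_iff_forall_notMem.2 fun x hx => ?_
  rw [mem_deleteSupport] at hx
  obtain ⟨hxX, hxv, hxl⟩ := hx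
  by_cases hx0 : x = O.root
  · subst hx0
    refine hxl ⟨Or.inr ⟨hxX, hvX, root_lt hv0, fun z hz h0z hzv => ?_⟩, hL.deg_hasse_root hne⟩
    exact hzv.2 (antisymm hzv.1 (hle z hz (ne_root_of_lt h0z)))
  · exact hxl (hup x hxX ⟨hle x hxX hx0, Ne.symm hxv⟩)

/-- Selecting `v` removes exactly the elements above `v` from the Hasse diagram; what remains is
smoothed to the Hasse diagram of the span of the leaves that are left. -/
theorem IsLeafSet.isSM_deleteSupport (hL : O.IsLeafSet L) {v a b : V} (hv0 : v ≠ O.root)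
    (hv : ∀ z, O.lt v z → ∀ a ∈ L, ∀ b ∈ L, O.le z a → O.le z b → a = b)
    (ha : a ∈ L) (hb : b ∈ L) (hab : a ≠ b) (hva : O.le v a) (hvb : O.le v b)
    (hL' : L \ {x | O.le v x} ≠ {O.root}) :
    IsSM (deleteSupport (O.hasse (O.span L)) v) (O.hasse (O.span (L \ {x | O.le v x}))) := by
  obtain ⟨hvX, hup, -⟩ := hL.isEndSupport hv0 hv ha hb hab hva hvb
  have hLs := hL.sdiff hv0
  obtain ⟨d, ⟨hd, hvd⟩, hd0⟩ : ∃ d ∈ L \ {x | O.le v x}, d ≠ O.root := by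
    by_contra hcon
    push Not at hcon
    exact hL' (Set.eq_singleton_iff_unique_mem.2 ⟨hLs.root_mem, hcon⟩)
  have ha0 : a ≠ O.root := by
    rintro rfl
    exact hv0 (antisymm hva (O.root_le v))
  -- a leaf that is not above `v` puts a meet between the root and `v`
  have hroot : ¬ O.Covers (O.span L) O.root v := by
    intro hcov
    obtain ⟨m, hm, hm0⟩ := hL.exists_isMeet hd ha hd0 ha0 (by rintro rfl; exact hvd hva)
    rcases le_or_lt hva hm.2.1.1 with h | h
    · exact hvd (O.trans _ _ _ h hm.1.1)
    · exact hcov.2.2.2 m (Or.inr ⟨d, hd, a, ha, hm⟩) (root_lt hm0) h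
  have hleaf : ∀ x ∈ leafNeighbors (O.hasse (O.span L)) v, O.le v x := by
    rintro x ⟨hx | hx, hdeg⟩
    · exact hx.2.2.1.1
    · exfalso
      have hx0 : x ≠ O.root := by
        rintro rfl
        exact hroot hx
      obtain ⟨u, hu, -⟩ := exists_covers_below (X := O.span L) (Or.inl hL.root_mem) hx.1
        (root_lt hx0)
      have huv : u = v := eq_of_adj_leaf hdeg (Or.inr hu) (Or.inl hx)
      subst huv
      exact hx.2.2.1.2 (antisymm hx.2.2.1.1 hu.2.2.1.1)
  have hmem : ∀ x ∈ O.span L, (x ≠ v ∧ x ∉ leafNeighbors (O.hasse (O.span L)) v ↔ ¬ O.le v x) := by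
    intro x hx
    constructor
    · rintro ⟨h1, h2⟩ h
      exact h2 (hup x hx ⟨h, h1.symm⟩)
    · intro h
      exact ⟨by rintro rfl; exact h (O.refl x), fun h' => h (hleaf x h')⟩
  have heq : deleteSupport (O.hasse (O.span L)) v = O.hasse (O.span L \ {x | O.le v x}) := by
    have hcov : ∀ x y, O.Covers (O.span L \ {x | O.le v x}) x y ↔
        ¬ O.le v x ∧ ¬ O.le v y ∧ O.Covers (O.span L) x y := by
      intro x y
      constructor
      · rintro ⟨h1, h2, h3, h4⟩
        refine ⟨h1.2, h2.2, h1.1, h2.1, h3, fun z hz hxz hzy => ?_⟩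
        exact h4 z ⟨hz, fun h => h2.2 (O.trans _ _ _ h hzy.1)⟩ hxz hzy
      · rintro ⟨h1, h2, h3⟩
        exact ⟨⟨h3.1, h1⟩, ⟨h3.2.1, h2⟩, h3.2.2.1, fun z hz => h3.2.2.2 z hz.1⟩
    apply SimpleGraph.Subgraph.ext
    · ext x
      rw [mem_deleteSupport]
      exact and_congr_right fun hx => hmem x hx
    · ext x y
      rw [deleteSupport_adj]
      change _ ↔ O.Covers _ x y ∨ O.Covers _ y x
      rw [hcov, hcov]
      constructor
      · rintro ⟨h1, h2, h⟩
        have hx := (hmem x h.fst_mem).1 h1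
        have hy := (hmem y h.snd_mem).1 h2
        exact h.imp (fun h => ⟨hx, hy, h⟩) fun h => ⟨hy, hx, h⟩
      · rintro (⟨h1, h2, h⟩ | ⟨h1, h2, h⟩)
        · exact ⟨(hmem x h.1).2 h1, (hmem y h.2.1).2 h2, Or.inl h⟩
        · exact ⟨(hmem x h.2.1).2 h2, (hmem y h.1).2 h1, Or.inr h⟩
  refine ⟨?_, hLs.deg_hasse_ne_two hL'⟩
  rw [heq]
  refine hLs.smoothings ?_ ?_
  · intro x hx
    refine ⟨span_mono Set.sdiff_subset hx, fun hvx => ?_⟩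
    obtain ⟨c, hc, hxc⟩ := exists_le_of_mem_span hx
    exact hc.2 (O.trans _ _ _ hvx hxc)
  · rintro y ⟨hy, hvy⟩
    obtain ⟨c, hc, hyc, hvc⟩ := exists_not_le_of_mem_span hy hvy
    exact ⟨c, ⟨hc, hvc⟩, hyc⟩

/-- If only the root and one other leaf are left, the Hasse diagram is a single edge. -/
theorem IsLeafSet.edge (hL : O.IsLeafSet L) {a : V} (ha : a ≠ O.root) (hLa : L = {O.root, a}) :
    IsEndSupport (O.hasse (O.span L)) O.root ∧
      (deleteSupport (O.hasse (O.span L)) O.root).verts = ∅ := by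
  have haL : a ∈ L := by rw [hLa]; exact Or.inr rfl
  have hspan : ∀ x ∈ O.span L, x = O.root ∨ x = a := by
    rintro x (hx | ⟨b, hb, c, hc, hm⟩)
    · rwa [hLa] at hx
    · have hb' := ne_root_of_lt hm.1
      have hc' := ne_root_of_lt hm.2.1
      rw [hLa] at hb hc
      have : b = c := (hb.resolve_left hb').trans (hc.resolve_left hc').symm
      subst this
      exact absurd (O.refl b) (hm.2.2 b hm.1 (O.refl b))
  have hdeg := hL.deg_hasse_root (by
    intro h
    rw [h] at haL
    exact ha haL)
  have hcov : O.Covers (O.span L) O.root a :=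
    ⟨Or.inl hL.root_mem, Or.inl haL, root_lt ha, fun z hz h0 h1 => by
      rcases hspan z hz with rfl | rfl
      · exact not_lt_self h0
      · exact not_lt_self h1⟩
  have hleaf : a ∈ leafNeighbors (O.hasse (O.span L)) O.root :=
    ⟨Or.inl hcov, hL.deg_hasse_of_ne_root haL ha⟩
  refine ⟨⟨⟨a, hleaf⟩, by rw [hdeg]; simp⟩, ?_⟩
  refine Set.eq_empty_iff_forall_notMem.2 fun x hx => ?_
  rw [mem_deleteSupport] at hx
  rcases hspan x hx.1 with rfl | rfl
  · exact hx.2.1 rfl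
  · exact hx.2.2 hleaf

end TreeOrder

end Hasse

/-! ### The order of a rooted tree -/

section RootedTree

variable {V : Type*} {T : SimpleGraph V}

/-- On a shortest path from `a` to `c`, the vertex before `c` is a neighbor of `c` closer to
the root. -/
theorem exists_adj_of_dist_add (hT : T.IsTree) {r a c : V}
    (hac : T.dist r a + T.dist a c = T.dist r c) (hne : a ≠ c) :
    ∃ z, T.Adj c z ∧ T.dist r z < T.dist r c ∧ T.dist r a + T.dist a z = T.dist r z := by
  obtain ⟨p, hp, hlen⟩ := hT.connected.exists_path_of_dist a c
  have hnil : ¬ p.Nil := fun h => hne h.eq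
  have hadj := p.adj_penultimate hnil
  have hlen' : p.dropLast.length + 1 = p.length := by
    conv_rhs => rw [← p.concat_dropLast hadj]
    rw [SimpleGraph.Walk.length_concat]
  have h1 := SimpleGraph.dist_le p.dropLast
  have h2 := hT.connected.dist_triangle (u := r) (v := a) (w := p.penultimate)
  have h3 := hT.connected.dist_triangle (u := a) (v := p.penultimate) (w := c)
  have h4 := hT.connected.dist_triangle (u := r) (v := p.penultimate) (w := c)
  have h5 := SimpleGraph.dist_eq_one_iff_adj.2 hadj
  exact ⟨p.penultimate, hadj.symm, by omega, by omega⟩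

/-- The order of a tree rooted at `r`: `a` lies below `b` if `a` is on the path from `r` to `b`. -/
noncomputable def treeOrder (hT : T.IsTree) (r : V) : TreeOrder V where
  le a b := T.dist r a + T.dist a b = T.dist r b
  depth := T.dist r
  root := r
  refl a := by simp
  trans a b c hab hbc := by
    have h1 := hT.connected.dist_triangle (u := a) (v := b) (w := c)
    have h2 := hT.connected.dist_triangle (u := r) (v := a) (w := c)
    omega
  root_le a := by simp
  depth_lt a b hab hne := by
    have := hT.connected.pos_dist_of_ne hne
    omega
  chain := by
    intro a b c
    induction hn : T.dist r c using Nat.strong_induction_on generalizing c with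
    | _ n ih =>
      intro ha hb
      rw [← hn] at ha hb
      by_cases hac : a = c
      · subst hac
        exact Or.inr hb
      by_cases hbc : b = c
      · subst hbc
        exact Or.inl ha
      obtain ⟨x, hx, hxd, hax⟩ := exists_adj_of_dist_add hT ha hac
      obtain ⟨y, hy, hyd, hby⟩ := exists_adj_of_dist_add hT hb hbc
      have : x = y := eq_of_dist_lt hT hx hy hxd hyd
      subst this
      exact ih _ (hn ▸ hxd) x rfl hax hby

variable {hT : T.IsTree} {r : V}

theorem treeOrder_lt_or_lt {a b : V} (h : T.Adj a b) :
    (treeOrder hT r).lt a b ∨ (treeOrder hT r).lt b a := by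
  have h1 := SimpleGraph.dist_eq_one_iff_adj.2 h
  have h2 := SimpleGraph.dist_eq_one_iff_adj.2 h.symm
  rcases hT.dist_eq_dist_add_one_of_adj r h with h3 | h3
  · exact Or.inr ⟨by change _ + _ = _; omega, h.ne'⟩
  · exact Or.inl ⟨by change _ + _ = _; omega, h.ne⟩

/-- The edges of a rooted tree are the covering pairs of its order. -/
theorem treeOrder_covers_iff {a b : V} :
    (treeOrder hT r).Covers Set.univ a b ↔ T.Adj a b ∧ (treeOrder hT r).lt a b := by
  constructor
  · rintro ⟨-, -, hab, hcov⟩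
    refine ⟨?_, hab⟩
    obtain ⟨z, hz, hzd, haz⟩ := exists_adj_of_dist_add hT hab.1 hab.2
    have hzb : (treeOrder hT r).lt z b := by
      refine (treeOrder_lt_or_lt hz).resolve_left fun h => ?_
      have h' : T.dist r b < T.dist r z := (treeOrder hT r).depth_lt _ _ h.1 h.2
      omega
    by_cases haz' : a = z
    · exact haz' ▸ hz.symm
    · exact absurd hzb (hcov z trivial ⟨haz, haz'⟩)
  · rintro ⟨hadj, hlt⟩
    refine ⟨trivial, trivial, hlt, fun z _ h1 h2 => ?_⟩
    have h3 : T.dist r a < T.dist r z := (treeOrder hT r).depth_lt _ _ h1.1 h1.2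
    have h4 : T.dist r z < T.dist r b := (treeOrder hT r).depth_lt _ _ h2.1 h2.2
    rcases hT.dist_eq_dist_add_one_of_adj r hadj with h5 | h5 <;> omega

theorem hasse_univ : (treeOrder hT r).hasse Set.univ = ofGraph T := by
  apply SimpleGraph.Subgraph.ext
  · rfl
  · ext a b
    change _ ∨ _ ↔ T.Adj a b
    rw [treeOrder_covers_iff, treeOrder_covers_iff]
    constructor
    · rintro (h | h)
      · exact h.1
      · exact h.1.symm
    · exact fun h => (treeOrder_lt_or_lt h).imp (fun h' => ⟨h, h'⟩) fun h' => ⟨h.symm, h'⟩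

/-- The parent of a vertex: the adjacent vertex below it. -/
def IsParent (hT : T.IsTree) (r p v : V) : Prop :=
  T.Adj v p ∧ (treeOrder hT r).lt p v

theorem IsParent.unique {p q v : V} (hp : IsParent hT r p v) (hq : IsParent hT r q v) : p = q :=
  (treeOrder_covers_iff.2 ⟨hp.1.symm, hp.2⟩).lower_unique
    (treeOrder_covers_iff.2 ⟨hq.1.symm, hq.2⟩)

theorem IsParent.le_of_lt {p v w : V} (hp : IsParent hT r p v) (hw : (treeOrder hT r).lt w v) :
    (treeOrder hT r).le w p := by
  refine (TreeOrder.le_or_lt hw.1 hp.2.1).resolve_right fun h => ?_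
  exact (treeOrder_covers_iff.2 ⟨hp.1.symm, hp.2⟩).2.2.2 w trivial h hw

theorem eq_or_lt_of_adj {p v w : V} (hp : IsParent hT r p v) (hw : T.Adj v w) :
    w = p ∨ (treeOrder hT r).lt v w :=
  (treeOrder_lt_or_lt hw).symm.imp_left fun h => IsParent.unique ⟨hw, h⟩ hp

variable [Finite V]

theorem exists_isParent {v : V} (hv : v ≠ r) : ∃ p, IsParent hT r p v := by
  obtain ⟨p, hp, -⟩ := TreeOrder.exists_covers_below (O := treeOrder hT r) (X := Set.univ)
    (a := r) (b := v) trivial trivial (TreeOrder.root_lt hv)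
  rw [treeOrder_covers_iff] at hp
  exact ⟨p, hp.1.symm, hp.2⟩

theorem exists_child_le {v z : V} (hz : (treeOrder hT r).lt v z) :
    ∃ c, T.Adj v c ∧ (treeOrder hT r).lt v c ∧ (treeOrder hT r).le c z := by
  obtain ⟨c, hc, hcz⟩ := TreeOrder.exists_covers_above (O := treeOrder hT r) (X := Set.univ)
    trivial trivial hz
  rw [treeOrder_covers_iff] at hc
  exact ⟨c, hc.1, hc.2, hcz⟩

end RootedTree

/-! ### Bottom-up selection -/

section Greedy

variable {V : Type*} {T : SimpleGraph V} {hT : T.IsTree} {r : V}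

theorem deg_eq_one_of_unique {v p : V} (hp : T.Adj v p)
    (h : ∀ w, T.Adj v w → w = p) : deg (ofGraph T) v = 1 :=
  deg_eq_one_iff.2 ⟨p, Set.eq_singleton_iff_unique_mem.2 ⟨hp, h⟩⟩

/-- The invariant of the bottom-up selection in the tree rooted at the leaf `r`. `D` is the set of
the vertices processed so far, `L` the set of the leaves not yet deleted, and `S` the list of
the vertices selected so far. Above a processed vertex at most one leaf is left. The current graph
of the algorithm is the Hasse diagram of the span of `L`, or empty when only `r` is left (the last
pass then has deleted `r` too). -/
structure GreedyState (hT : T.IsTree) (r : V) (D L : Set V) (S : List V) : Prop where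
  upper : ∀ a b, (treeOrder hT r).le a b → a ∈ D → b ∈ D
  root_notMem : r ∉ D
  leaves : (treeOrder hT r).IsLeafSet L
  few : ∀ z ∈ D, ∀ a ∈ L, ∀ b ∈ L, (treeOrder hT r).le z a → (treeOrder hT r).le z b → a = b
  graph : ∃ G : PGraph V, Reachable T ⟨G, S⟩ ∧
    ((L = {r} ∧ G.verts = ∅) ∨
      (L ≠ {r} ∧ G = (treeOrder hT r).hasse ((treeOrder hT r).span L)))

theorem GreedyState.upper_insert {D L : Set V} {S : List V} (h : GreedyState hT r D L S) {v : V}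
    (hv : ∀ z, (treeOrder hT r).lt v z → z ∈ D) (a b : V) (hab : (treeOrder hT r).le a b)
    (ha : a ∈ insert v D) : b ∈ insert v D := by
  rcases ha with rfl | ha
  · by_cases hb : b = a
    · exact Or.inl hb
    · exact Or.inr (hv b ⟨hab, Ne.symm hb⟩)
  · exact Or.inr (h.upper a b hab ha)

theorem GreedyState.returns_of_eq {D L : Set V} {S : List V} (h : GreedyState hT r D L S)
    (hL : L = {r}) : Returns T S := by
  obtain ⟨G, hG, ⟨-, hcase⟩ | ⟨hL', -⟩⟩ := h.graph
  · exact ⟨_, hG, hcase, rfl⟩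
  · exact absurd hL hL'

/-- A vertex with at most one remaining leaf above it is processed without being selected. -/
theorem GreedyState.keep {D L : Set V} {S : List V} (h : GreedyState hT r D L S) {v : V}
    (hv0 : v ≠ r) (hv : ∀ z, (treeOrder hT r).lt v z → z ∈ D)
    (hone : ∀ a ∈ L, ∀ b ∈ L, (treeOrder hT r).le v a → (treeOrder hT r).le v b → a = b) :
    GreedyState hT r (insert v D) L S := by
  refine ⟨h.upper_insert hv, ?_, h.leaves, ?_, h.graph⟩
  · rintro (h' | h')
    · exact hv0 h'.symm
    · exact h.root_notMem h'
  · rintro z (rfl | hz)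
    · exact hone
    · exact h.few z hz

variable [Finite V]

theorem isLeafSet_leaves (hr : deg (ofGraph T) r = 1) :
    (treeOrder hT r).IsLeafSet {v | deg (ofGraph T) v = 1} := by
  refine ⟨hr, fun a ha ha0 z haz => ?_, fun a b hm => ?_⟩
  · obtain ⟨p, hp⟩ := exists_isParent (hT := hT) ha0
    obtain ⟨c, hc, hac, -⟩ := exists_child_le haz
    have : p = c := eq_of_adj_leaf (G := ofGraph T) ha hp.1 hc
    subst this
    exact hac.2 (TreeOrder.antisymm hac.1 hp.2.1)
  · obtain ⟨c, hc, h0c, hca⟩ := exists_child_le hm.1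
    obtain ⟨d, hd, -, hdb⟩ := exists_child_le hm.2.1
    have : c = d := eq_of_adj_leaf (G := ofGraph T) hr hc hd
    subst this
    exact hm.2.2 c h0c hca hdb

theorem exists_leaf_above (hr : deg (ofGraph T) r = 1) (y : V) :
    ∃ a ∈ {v | deg (ofGraph T) v = 1}, (treeOrder hT r).le y a := by
  obtain ⟨a, hya, hmax⟩ := Set.exists_max_image {z | (treeOrder hT r).le y z}
    (treeOrder hT r).depth (Set.toFinite _) ⟨y, (treeOrder hT r).refl y⟩
  refine ⟨a, ?_, hya⟩
  by_cases ha : a = r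
  · exact ha ▸ hr
  obtain ⟨p, hp⟩ := exists_isParent (hT := hT) ha
  refine deg_eq_one_of_unique hp.1 fun w hw => ?_
  refine (eq_or_lt_of_adj hp hw).resolve_right fun h => ?_
  have := hmax w ((treeOrder hT r).trans _ _ _ hya h.1)
  have := (treeOrder hT r).depth_lt _ _ h.1 h.2
  omega

theorem GreedyState.start (hr : deg (ofGraph T) r = 1) :
    GreedyState hT r ∅ {v | deg (ofGraph T) v = 1} [] := by
  have hL := isLeafSet_leaves (hT := hT) hr
  have hne : {v | deg (ofGraph T) v = 1} ≠ {r} := by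
    obtain ⟨c, hc⟩ := deg_eq_one_iff.1 hr
    have hadj : T.Adj r c := by
      have : c ∈ (ofGraph T).neighborSet r := by rw [hc]; rfl
      exact this
    obtain ⟨a, ha, hca⟩ := exists_leaf_above (hT := hT) hr c
    intro h
    rw [h] at ha
    have h0 : c = r := TreeOrder.antisymm (O := treeOrder hT r) (ha ▸ hca)
      ((treeOrder hT r).root_le c)
    exact hadj.ne h0.symm
  refine ⟨fun _ _ _ h => h.elim, fun h => h, hL, fun z hz => hz.elim, ?_⟩
  refine ⟨_, ⟨⟨_, []⟩, ⟨?_, rfl⟩, Relation.ReflTransGen.refl⟩, Or.inr ⟨hne, rfl⟩⟩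
  refine ⟨?_, hL.deg_hasse_ne_two hne⟩
  have := hL.smoothings (Y := Set.univ) (Set.subset_univ _) fun y _ => exists_leaf_above hr y
  rwa [hasse_univ] at this

/-- A vertex with at least two remaining leaves above it is selected. -/
theorem GreedyState.select {D L : Set V} {S : List V} (h : GreedyState hT r D L S) {v a b : V}
    (hv0 : v ≠ r) (hv : ∀ z, (treeOrder hT r).lt v z → z ∈ D)
    (ha : a ∈ L) (hb : b ∈ L) (hab : a ≠ b) (hva : (treeOrder hT r).le v a)
    (hvb : (treeOrder hT r).le v b) :
    GreedyState hT r (insert v D) (L \ {x | (treeOrder hT r).le v x}) (S ++ [v]) := by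
  obtain ⟨G, hG, hcase⟩ := h.graph
  refine ⟨h.upper_insert hv, ?_, h.leaves.sdiff hv0, ?_, ?_⟩
  · rintro (h' | h')
    · exact hv0 h'.symm
    · exact h.root_notMem h'
  · rintro z (rfl | hz) c hc d hd hzc hzd
    · exact absurd hzc hc.2
    · exact h.few z hz c hc.1 d hd.1 hzc hzd
  · rcases hcase with ⟨hL, -⟩ | ⟨-, rfl⟩
    · rw [hL] at ha hb
      exact absurd (ha.trans hb.symm) hab
    · have hfew : ∀ z, (treeOrder hT r).lt v z → ∀ a ∈ L, ∀ b ∈ L, (treeOrder hT r).le z a →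
          (treeOrder hT r).le z b → a = b := fun z hz => h.few z (hv z hz)
      obtain ⟨hvX, -, hend⟩ := h.leaves.isEndSupport hv0 hfew ha hb hab hva hvb
      obtain ⟨c₀, h0, hreach⟩ := hG
      by_cases hL' : L \ {x | (treeOrder hT r).le v x} = {r}
      · have hempty := h.leaves.deleteSupport_eq_empty hv0 hfew ha hb hab hva hvb hL'
        refine ⟨_, ⟨c₀, h0, hreach.tail ⟨⟨v, hvX⟩, v, hend, rfl, Relation.ReflTransGen.refl, ?_⟩⟩,
          Or.inl ⟨hL', hempty⟩⟩
        intro x hx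
        change x ∈ (deleteSupport _ v).verts at hx
        rw [hempty] at hx
        exact hx.elim
      · exact ⟨_, ⟨c₀, h0, hreach.tail ⟨⟨v, hvX⟩, v, hend, rfl,
          h.leaves.isSM_deleteSupport hv0 hfew ha hb hab hva hvb hL'⟩⟩, Or.inr ⟨hL', rfl⟩⟩

/-- If two leaves are left when everything but the root has been processed, then the root is one of
them, and it is the last vertex to be selected. -/
theorem GreedyState.returns_of_ne {D L : Set V} {S : List V} (h : GreedyState hT r D L S)
    (hD : ∀ v, v ≠ r → v ∈ D) (hL : L ≠ {r}) : Returns T (S ++ [r]) := by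
  obtain ⟨G, ⟨c₀, h0, hreach⟩, ⟨hL', -⟩ | ⟨-, rfl⟩⟩ := h.graph
  · exact absurd hL' hL
  obtain ⟨a, ha, ha0⟩ : ∃ a ∈ L, a ≠ r := by
    by_contra hcon
    push Not at hcon
    exact hL (Set.eq_singleton_iff_unique_mem.2 ⟨h.leaves.root_mem, hcon⟩)
  have hLa : L = {r, a} := by
    ext b
    constructor
    · intro hb
      by_cases hb0 : b = r
      · exact Or.inl hb0
      · right
        by_contra hab
        obtain ⟨m, hm, hm0⟩ := h.leaves.exists_isMeet ha hb ha0 hb0 (Ne.symm hab)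
        exact hab (h.few m (hD m hm0) b hb a ha hm.2.1.1 hm.1.1)
    · rintro (rfl | rfl)
      · exact h.leaves.root_mem
      · exact ha
  obtain ⟨hend, hempty⟩ := h.leaves.edge ha0 hLa
  refine ⟨⟨_, _⟩, ⟨c₀, h0, hreach.tail ⟨⟨r, Or.inl h.leaves.root_mem⟩, r, hend, rfl,
    Relation.ReflTransGen.refl, ?_⟩⟩, hempty, rfl⟩
  intro x hx
  change x ∈ (deleteSupport ((treeOrder hT r).hasse _) r).verts at hx
  have h2 : (deleteSupport ((treeOrder hT r).hasse ((treeOrder hT r).span L)) r).verts = ∅ := hempty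
  rw [h2] at hx
  exact hx.elim

end Greedy

/-! ### Pending leaves and remaining neighbors -/

section Counters

variable {V : Type*} {T : SimpleGraph V} {hT : T.IsTree} {r : V} {D L : Set V} {S : List V}

/-- The leaves of `L` that are reported to the vertex `w` once the vertices of `D` have been
processed: those above `w` to which only processed vertices lead up from `w`. -/
def pending (hT : T.IsTree) (r : V) (D L : Set V) (w : V) : Set V :=
  {a | a ∈ L ∧ (treeOrder hT r).le w a ∧
    ∀ z, (treeOrder hT r).lt w z → (treeOrder hT r).le z a → z ∈ D}

theorem pending_eq_of_upper {v : V} (hv : ∀ z, (treeOrder hT r).lt v z → z ∈ D) :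
    pending hT r D L v = {a | a ∈ L ∧ (treeOrder hT r).le v a} :=
  Set.ext fun _ => ⟨fun h => ⟨h.1, h.2.1⟩, fun h => ⟨h.1, h.2, fun z hz _ => hv z hz⟩⟩

theorem pending_empty {w : V} :
    pending hT r ∅ L w = {a | a ∈ L ∧ a = w} := by
  ext a
  constructor
  · rintro ⟨h1, h2, h3⟩
    refine ⟨h1, ?_⟩
    by_contra hne
    exact h3 a ⟨h2, Ne.symm hne⟩ ((treeOrder hT r).refl a)
  · rintro ⟨h1, rfl⟩
    exact ⟨h1, (treeOrder hT r).refl a, fun z hz hza => hz.2 (TreeOrder.antisymm hz.1 hza)⟩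

/-- A vertex that is processed without being selected reports its pending leaves to its parent. -/
theorem pending_parent {v p : V} (hp : IsParent hT r p v)
    (hv : ∀ z, (treeOrder hT r).lt v z → z ∈ D) :
    pending hT r (insert v D) L p = pending hT r D L p ∪ pending hT r D L v := by
  ext a
  constructor
  · rintro ⟨h1, h2, h3⟩
    by_cases hva : (treeOrder hT r).le v a
    · exact Or.inr ⟨h1, hva, fun z hz _ => hv z hz⟩
    · refine Or.inl ⟨h1, h2, fun z hz hza => (h3 z hz hza).resolve_left ?_⟩
      rintro rfl
      exact hva hza
  · rintro (⟨h1, h2, h3⟩ | ⟨h1, h2, h3⟩)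
    · exact ⟨h1, h2, fun z hz hza => Or.inr (h3 z hz hza)⟩
    · refine ⟨h1, (TreeOrder.lt_of_lt_of_le hp.2 h2).1, fun z hz hza => ?_⟩
      rcases TreeOrder.le_or_lt h2 hza with h4 | h4
      · by_cases hvz : v = z
        · exact Or.inl hvz.symm
        · exact Or.inr (hv z ⟨h4, hvz⟩)
      · exact absurd (TreeOrder.antisymm hz.1 (hp.le_of_lt h4)) hz.2

theorem disjoint_pending {v p : V} (hp : IsParent hT r p v) (hvD : v ∉ D) :
    Disjoint (pending hT r D L p) (pending hT r D L v) :=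
  Set.disjoint_left.2 fun _ h1 h2 => hvD (h1.2.2 v hp.2 h2.2.1)

theorem GreedyState.pending_of_ne (h : GreedyState hT r D L S) {v p w : V}
    (hp : IsParent hT r p v) (hvD : v ∉ D) (hw : w ∉ insert v D) (hwp : w ≠ p) :
    pending hT r (insert v D) L w = pending hT r D L w := by
  ext a
  refine ⟨fun ⟨h1, h2, h3⟩ => ⟨h1, h2, fun z hz hza => (h3 z hz hza).resolve_left ?_⟩,
    fun ⟨h1, h2, h3⟩ => ⟨h1, h2, fun z hz hza => Or.inr (h3 z hz hza)⟩⟩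
  rintro rfl
  have hwp' : (treeOrder hT r).lt w p := ⟨hp.le_of_lt hz, hwp⟩
  rcases h3 p hwp' (TreeOrder.lt_of_lt_of_le hp.2 hza).1 with h4 | h4
  · exact hp.2.2 h4
  · exact hvD (h.upper p z hp.2.1 h4)

/-- The selection of `v` does not change what is reported to the other vertices. -/
theorem pending_select {v w : V} (hvD : v ∉ D)
    (hv : ∀ z, (treeOrder hT r).lt v z → z ∈ D) (hw : w ∉ insert v D) :
    pending hT r (insert v D) (L \ {x | (treeOrder hT r).le v x}) w = pending hT r D L w := by
  have hwv : w ≠ v := fun h => hw (Or.inl h)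
  ext a
  constructor
  · rintro ⟨h1, h2, h3⟩
    refine ⟨h1.1, h2, fun z hz hza => (h3 z hz hza).resolve_left ?_⟩
    rintro rfl
    exact h1.2 hza
  · rintro ⟨h1, h2, h3⟩
    refine ⟨⟨h1, fun hva => ?_⟩, h2, fun z hz hza => Or.inr (h3 z hz hza)⟩
    rcases TreeOrder.le_or_lt h2 hva with h4 | h4
    · exact hvD (h3 v ⟨h4, hwv⟩ hva)
    · exact hw (Or.inr (hv w h4))

theorem not_adj_of_ne_parent {v p w : V} (hp : IsParent hT r p v)
    (hv : ∀ z, (treeOrder hT r).lt v z → z ∈ D) (hw : w ∉ D) (hwp : w ≠ p) : ¬ T.Adj w v :=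
  fun h => (eq_or_lt_of_adj hp h.symm).elim hwp fun h' => hw (hv w h')

open Classical in
/-- The sum of `g` over the neighbors of `w` that have not been processed. -/
noncomputable def restSum [Fintype V] (T : SimpleGraph V) (g : V → ℕ) (D : Set V) (w : V) : ℕ :=
  ∑ x, if T.Adj w x ∧ x ∉ D then g x else 0

variable [Fintype V] {g : V → ℕ}

theorem restSum_insert_of_not_adj {v w : V} (h : ¬ T.Adj w v) :
    restSum T g (insert v D) w = restSum T g D w := by
  unfold restSum
  refine Finset.sum_congr rfl fun x _ => ?_
  have : T.Adj w x ∧ x ∉ insert v D ↔ T.Adj w x ∧ x ∉ D := by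
    rw [Set.mem_insert_iff]
    refine and_congr_right fun hx => not_congr (or_iff_right ?_)
    rintro rfl
    exact h hx
  congr 1
  exact propext this

theorem restSum_insert_of_adj {v w : V} (h : T.Adj w v) (hv : v ∉ D) :
    restSum T g D w = restSum T g (insert v D) w + g v := by
  classical
  have : g v = ∑ x, if x = v then g x else 0 := by simp
  rw [this, restSum, restSum, ← Finset.sum_add_distrib]
  refine Finset.sum_congr rfl fun x _ => ?_
  by_cases hx : x = v
  · subst hx
    simp [h, hv]
  · simp [hx]

theorem restSum_of_unique {v p : V} (h : ∀ x, (T.Adj v x ∧ x ∉ D) ↔ x = p) :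
    restSum T g D v = g p := by
  classical
  simp [restSum, h]

theorem restSum_one {w : V} : restSum T (fun _ => 1) D w = {x | T.Adj w x ∧ x ∉ D}.ncard := by
  classical
  rw [restSum, Finset.sum_boole, Nat.cast_id, Set.ncard_eq_toFinset_card']
  congr 1
  ext x
  simp

theorem restSum_one_empty {w : V} : restSum T (fun _ => 1) ∅ w = deg (ofGraph T) w := by
  rw [restSum_one, deg]
  congr 1
  ext x
  simp [ofGraph]

/-- A vertex other than the root with only one neighbor not yet processed: this neighbor is
the parent, and everything above the vertex has been processed. -/
theorem GreedyState.of_restSum_eq_one (h : GreedyState hT r D L S) {v : V} (hvD : v ∉ D)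
    (hv0 : v ≠ r) (h1 : restSum T (fun _ => 1) D v = 1) :
    ∃ p, IsParent hT r p v ∧ p ∉ D ∧ (∀ x, (T.Adj v x ∧ x ∉ D) ↔ x = p) ∧
      ∀ z, (treeOrder hT r).lt v z → z ∈ D := by
  obtain ⟨p, hp⟩ := exists_isParent (hT := hT) hv0
  have hpD : p ∉ D := fun h' => hvD (h.upper p v hp.2.1 h')
  rw [restSum_one, Set.ncard_eq_one] at h1
  obtain ⟨q, hq⟩ := h1
  have hpq : p ∈ {x | T.Adj v x ∧ x ∉ D} := ⟨hp.1, hpD⟩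
  rw [hq, Set.mem_singleton_iff] at hpq
  subst hpq
  have hiff : ∀ x, (T.Adj v x ∧ x ∉ D) ↔ x = p := fun x => by
    have : x ∈ {x | T.Adj v x ∧ x ∉ D} ↔ x ∈ ({p} : Set V) := by rw [hq]
    exact this
  refine ⟨p, hp, hpD, hiff, fun z hz => ?_⟩
  obtain ⟨c, hc, hvc, hcz⟩ := exists_child_le hz
  refine h.upper c z hcz (by_contra fun hcD => ?_)
  have hcp := (hiff c).1 ⟨hc, hcD⟩
  subst hcp
  exact hvc.2 (TreeOrder.antisymm hvc.1 hp.2.1)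

/-- As long as a vertex other than the root is left, some such vertex has only one neighbor not yet
processed. -/
theorem GreedyState.mem_of_restSum_ne_one
    (hne : ∀ w, w ∉ D → w ≠ r → restSum T (fun _ => 1) D w ≠ 1)
    (h : GreedyState hT r D L S) (v : V) (hv : v ≠ r) : v ∈ D := by
  by_contra hvD
  obtain ⟨w, ⟨hwD, hw0⟩, hmax⟩ := Set.exists_max_image {w | w ∉ D ∧ w ≠ r} (treeOrder hT r).depth
    (Set.toFinite _) ⟨v, hvD, hv⟩
  obtain ⟨p, hp⟩ := exists_isParent (hT := hT) hw0
  refine hne w hwD hw0 (restSum_of_unique (p := p) fun x => ⟨fun hx => ?_, ?_⟩)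
  · refine (eq_or_lt_of_adj hp hx.1).resolve_right fun hlt => ?_
    have := hmax x ⟨hx.2, TreeOrder.ne_root_of_lt hlt⟩
    have := (treeOrder hT r).depth_lt _ _ hlt.1 hlt.2
    omega
  · rintro rfl
    exact ⟨hp.1, fun h' => hwD (h.upper x w hp.2.1 h')⟩

end Counters

/-! ### Sums over an edge list -/

section EdgeList

variable {n : ℕ}

/-- What the listed edges contribute to the sum of `g` over the neighbors of `v`. -/
def edgeSum (g : Fin n → ℕ) (v : Fin n) (es : List (Fin n × Fin n)) : ℕ :=
  (es.map fun e => (if e.1 = v then g e.2 else 0) + if e.2 = v then g e.1 else 0).sum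

theorem edgeSum_eq (g : Fin n → ℕ) (v : Fin n) (es : List (Fin n × Fin n))
    (hnd : (es.map fun e => s(e.1, e.2)).Nodup) (hloop : ∀ e ∈ es, e.1 ≠ e.2) :
    edgeSum g v es = ∑ w, if s(v, w) ∈ es.map (fun e => s(e.1, e.2)) then g w else 0 := by
  induction es with
  | nil => simp [edgeSum]
  | cons e es ih =>
    rw [List.map_cons, List.nodup_cons] at hnd
    have ih := ih hnd.2 fun e he => hloop e (List.mem_cons_of_mem _ he)
    have hne := hloop e List.mem_cons_self
    have hsplit : ∀ w, (if s(v, w) ∈ (e :: es).map (fun e => s(e.1, e.2)) then g w else 0) =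
        (if s(v, w) = s(e.1, e.2) then g w else 0) +
          if s(v, w) ∈ es.map (fun e => s(e.1, e.2)) then g w else 0 := by
      intro w
      simp only [List.map_cons, List.mem_cons]
      by_cases h : s(v, w) = s(e.1, e.2)
      · simp only [h, hnd.1]
        simp
      · simp [h]
    rw [Finset.sum_congr rfl fun w _ => hsplit w, Finset.sum_add_distrib, ← ih]
    have hhead : ∑ w, (if s(v, w) = s(e.1, e.2) then g w else 0) =
        (if e.1 = v then g e.2 else 0) + if e.2 = v then g e.1 else 0 := by
      by_cases h1 : e.1 = v
      · have h2 : e.2 ≠ v := fun h => hne (h1.trans h.symm)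
        have : ∀ w, s(v, w) = s(e.1, e.2) ↔ w = e.2 := by
          intro w
          rw [h1, Sym2.eq_iff]
          grind
        simp only [this]
        simp [h1, h2]
      · by_cases h2 : e.2 = v
        · have : ∀ w, s(v, w) = s(e.1, e.2) ↔ w = e.1 := by
            intro w
            rw [h2, Sym2.eq_iff]
            grind
          simp only [this]
          simp [h1, h2]
        · have : ∀ w, s(v, w) ≠ s(e.1, e.2) := by
            intro w
            rw [Ne, Sym2.eq_iff]
            grind
          simp only [this]
          simp [h1, h2]
    rw [hhead]
    simp [edgeSum]

theorem IsEdgeList.edgeSum_eq {T : SimpleGraph (Fin n)} {es : List (Fin n × Fin n)}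
    (h : IsEdgeList T es) (g : Fin n → ℕ) (v : Fin n) : edgeSum g v es = restSum T g ∅ v := by
  rw [GeodesicTransversal.edgeSum_eq g v es h.1]
  · unfold restSum
    refine Finset.sum_congr rfl fun w _ => ?_
    congr 1
    rw [h.2, SimpleGraph.mem_edgeSet]
    simp
  · intro e he
    have : s(e.1, e.2) ∈ T.edgeSet := (h.2 _).1 (List.mem_map.2 ⟨e, he, rfl⟩)
    exact T.ne_of_adj this

theorem IsEdgeList.length {T : SimpleGraph (Fin n)} {es : List (Fin n × Fin n)}
    (h : IsEdgeList T es) (hT : T.IsTree) : es.length + 1 = n := by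
  classical
  have h1 := hT.card_edgeFinset
  rw [Fintype.card_fin] at h1
  have h2 : (es.map fun e => s(e.1, e.2)).toFinset = T.edgeFinset := by
    ext e
    rw [List.mem_toFinset, h.2, SimpleGraph.mem_edgeFinset]
  have h3 := List.toFinset_card_of_nodup h.1
  rw [h2, List.length_map] at h3
  omega

end EdgeList

/-! ### Reasoning about programs -/

section Machine

variable {W : ℕ} {s : Store} {Q R : Store → ℕ → Prop}

@[simp] theorem Store.setReg_reg (s : Store) (x k y : ℕ) :
    (s.setReg x k).reg y = if y = x then k else s.reg y := by
  simp [Store.setReg, Function.update_apply]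

@[simp] theorem Store.setReg_arr (s : Store) (x k : ℕ) : (s.setReg x k).arr = s.arr := rfl

@[simp] theorem Store.setArr_reg (s : Store) (a i k : ℕ) : (s.setArr a i k).reg = s.reg := rfl

@[simp] theorem Store.setArr_arr (s : Store) (a i k b j : ℕ) :
    (s.setArr a i k).arr b j = if b = a ∧ j = i then k else s.arr b j := by
  by_cases hb : b = a
  · subst hb
    simp [Store.setArr, Function.update_apply]
  · simp [Store.setArr, hb]

/-- Started in `s`, the program `P` halts, and the final store and the number of steps satisfy
`Q`. -/
def Runs (W : ℕ) (P : Prog) (s : Store) (Q : Store → ℕ → Prop) : Prop :=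
  ∃ s' t, Exec W P s s' t ∧ Q s' t

theorem Runs.mono {P : Prog} (h : Runs W P s Q) (hQR : ∀ s' t, Q s' t → R s' t) : Runs W P s R :=
  let ⟨s', t, h1, h2⟩ := h
  ⟨s', t, h1, hQR s' t h2⟩

/-- The programs of a list, one after the other. -/
def block : List Prog → Prog
  | [] => .skip
  | P :: Ps => .seq P (block Ps)

theorem runs_skip : Runs W .skip s Q ↔ Q s 1 :=
  ⟨fun ⟨_, _, h, hQ⟩ => by cases h; exact hQ, fun h => ⟨_, _, .skip s, h⟩⟩

theorem runs_const {x c : ℕ} : Runs W (.const x c) s Q ↔ c ≤ W ∧ Q (s.setReg x c) 1 :=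
  ⟨fun ⟨_, _, h, hQ⟩ => by cases h with | const _ _ _ hc => exact ⟨hc, hQ⟩,
    fun h => ⟨_, _, .const x c s h.1, h.2⟩⟩

theorem runs_move {x y : ℕ} : Runs W (.move x y) s Q ↔ Q (s.setReg x (s.reg y)) 1 :=
  ⟨fun ⟨_, _, h, hQ⟩ => by cases h; exact hQ, fun h => ⟨_, _, .move x y s, h⟩⟩

theorem runs_add {x y z : ℕ} : Runs W (.add x y z) s Q ↔
    s.reg y + s.reg z ≤ W ∧ Q (s.setReg x (s.reg y + s.reg z)) 1 :=
  ⟨fun ⟨_, _, h, hQ⟩ => by cases h with | add _ _ _ _ hc => exact ⟨hc, hQ⟩,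
    fun h => ⟨_, _, .add x y z s h.1, h.2⟩⟩

theorem runs_sub {x y z : ℕ} : Runs W (.sub x y z) s Q ↔
    Q (s.setReg x (s.reg y - s.reg z)) 1 :=
  ⟨fun ⟨_, _, h, hQ⟩ => by cases h; exact hQ, fun h => ⟨_, _, .sub x y z s, h⟩⟩

theorem runs_load {x a y : ℕ} : Runs W (.load x a y) s Q ↔
    Q (s.setReg x (s.arr a (s.reg y))) 1 :=
  ⟨fun ⟨_, _, h, hQ⟩ => by cases h; exact hQ, fun h => ⟨_, _, .load x a y s, h⟩⟩

theorem runs_store {a x y : ℕ} : Runs W (.store a x y) s Q ↔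
    Q (s.setArr a (s.reg x) (s.reg y)) 1 :=
  ⟨fun ⟨_, _, h, hQ⟩ => by cases h; exact hQ, fun h => ⟨_, _, .store a x y s, h⟩⟩

theorem runs_nil : Runs W (block []) s Q ↔ Q s 1 := runs_skip

theorem runs_cons {P : Prog} {Ps : List Prog} : Runs W (block (P :: Ps)) s Q ↔
    Runs W P s fun s' t => Runs W (block Ps) s' fun s'' t' => Q s'' (t + t') := by
  constructor
  · rintro ⟨_, _, h, hQ⟩
    cases h with
    | seq h1 h2 => exact ⟨_, _, h1, _, _, h2, hQ⟩
  · rintro ⟨_, _, h1, _, _, h2, hQ⟩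
    exact ⟨_, _, .seq h1 h2, hQ⟩

theorem runs_ite_of_holds {b : Test} {P P' : Prog} (hb : b.Holds s)
    (h : Runs W P s fun s' t => Q s' (1 + t)) : Runs W (.ite b P P') s Q :=
  let ⟨_, _, h1, h2⟩ := h
  ⟨_, _, .ite_true hb h1, h2⟩

theorem runs_ite_of_not_holds {b : Test} {P P' : Prog} (hb : ¬ b.Holds s)
    (h : Runs W P' s fun s' t => Q s' (1 + t)) : Runs W (.ite b P P') s Q :=
  let ⟨_, _, h1, h2⟩ := h
  ⟨_, _, .ite_false hb h1, h2⟩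

/-- The rule for loops, with amortized time: the invariant `I` carries a budget `m`, from which
every pass through the loop pays its own steps. -/
theorem Runs.loop {b : Test} {P : Prog} {I : Store → ℕ → Prop}
    (hbody : ∀ s m, I s m → b.Holds s →
      Runs W P s fun s' t => ∃ m', I s' m' ∧ 1 + t + m' ≤ m) {m : ℕ} (h : I s m) :
    Runs W (.loop b P) s fun s' t => ∃ m', I s' m' ∧ ¬ b.Holds s' ∧ t + m' ≤ 1 + m := by
  induction m using Nat.strong_induction_on generalizing s with
  | _ m ih =>
    by_cases hb : b.Holds s
    · obtain ⟨s', t, hE, m', hI, hm⟩ := hbody s m h hb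
      obtain ⟨s'', t', hE', m'', hI', hb', hm'⟩ := ih m' (by omega) hI
      exact ⟨s'', _, .loop_true hb hE hE', m'', hI', hb', by omega⟩
    · exact ⟨s, 1, .loop_false hb, m, h, hb, by omega⟩

end Machine

/-! ### The program, and its first two loops -/

section Program

/-- Append the number in register `x` to the output list. -/
def appendReg (x : ℕ) : Prog := block [.store 2 1 x, .add 1 1 2]

/-- Process the edge with number `R 4`: array `3` counts the neighbors of each vertex, and array `4`
sums them up. -/
def edgeBody : Prog := block [.load 5 0 4, .load 6 1 4,
  .load 7 3 5, .add 7 7 2, .store 3 5 7, .load 7 4 5, .add 7 7 6, .store 4 5 7,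
  .load 7 3 6, .add 7 7 2, .store 3 6 7, .load 7 4 6, .add 7 7 5, .store 4 6 7, .add 4 4 2]

/-- If the vertex `R 4` is a leaf, it becomes the root `R 8`, and its own pending leaf is entered
into array `5`. -/
def scanBody : Prog := block
  [.load 7 3 4, .ite (.eq 7 2) (block [.store 5 4 2, .move 8 4]) .skip, .add 4 4 2]

/-- Prune the vertex `R 5`, whose only remaining neighbor is its parent: the parent is the sum of
the remaining neighbors. Select the vertex if it has at least two pending leaves; otherwise report
them to the parent. Go on with the parent. -/
def pruneBody : Prog := block [.load 6 4 5, .store 3 5 9,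
  .load 7 3 6, .sub 7 7 2, .store 3 6 7, .load 10 4 6, .sub 10 10 5, .store 4 6 10, .load 10 5 5,
  .ite (.lt 2 10) (appendReg 5) (block [.load 11 5 6, .add 11 11 10, .store 5 6 11]), .move 5 6]

/-- Prune the vertex `R 4` and then its ancestors as long as they have one remaining neighbor. -/
def chainBody : Prog := block
  [.move 5 4, .load 7 3 5, .loop (.eq 7 2) pruneBody, .add 4 4 2]

/-- The linear-time algorithm. Register `0` holds the number of vertices, register `1` the length of
the output, register `2` the number one, register `8` the root, and register `9`, which is never
written, the number zero. The degree of the root is set to zero so that the root is never pruned. -/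
def mainProg : Prog := block [.const 2 1, .ite (.eq 0 2) (appendReg 9) (block
  [.sub 3 0 2, .loop (.lt 4 3) edgeBody, .const 4 0, .loop (.lt 4 0) scanBody, .store 3 8 9,
    .const 4 0, .loop (.lt 4 0) chainBody, .load 10 5 8, .ite (.lt 2 10) (appendReg 8) .skip])]

theorem IsOutput.append {n : ℕ} {s s' : Store} {S : List (Fin n)} {v : Fin n} (h : IsOutput s S)
    (hreg : s'.reg 1 = s.reg 1 + 1)
    (harr : ∀ i, s'.arr 2 i = if i = s.reg 1 then (v : ℕ) else s.arr 2 i) :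
    IsOutput s' (S ++ [v]) := by
  refine ⟨by rw [hreg, h.1]; simp, fun i hi => ?_⟩
  rw [harr, h.1]
  by_cases hiS : i < S.length
  · rw [if_neg (by omega), h.2 i hiS, List.getElem_append_left hiS]
  · have : i = S.length := by
      rw [List.length_append, List.length_singleton] at hi
      omega
    subst this
    simp

theorem IsOutput.congr {n : ℕ} {s s' : Store} {S : List (Fin n)} (h : IsOutput s S)
    (hreg : s'.reg 1 = s.reg 1) (harr : ∀ i, s'.arr 2 i = s.arr 2 i) : IsOutput s' S :=
  ⟨hreg.trans h.1, fun i hi => (harr i).trans (h.2 i hi)⟩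

variable {n W : ℕ} {T : SimpleGraph (Fin n)} {es : List (Fin n × Fin n)}

theorem edgeSum_append (g : Fin n → ℕ) (v : Fin n) (es es' : List (Fin n × Fin n)) :
    edgeSum g v (es ++ es') = edgeSum g v es + edgeSum g v es' := by
  simp [edgeSum]

theorem edgeSum_take_le (g : Fin n → ℕ) (v : Fin n) (es : List (Fin n × Fin n)) (k : ℕ) :
    edgeSum g v (es.take k) ≤ edgeSum g v es := by
  conv_rhs => rw [← List.take_append_drop k es, edgeSum_append]
  omega

theorem restSum_le {g : Fin n → ℕ} {c : ℕ} (hg : ∀ x, g x ≤ c) (D : Set (Fin n)) (v : Fin n) :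
    restSum T g D v ≤ n * c := by
  classical
  unfold restSum
  refine (Finset.sum_le_card_nsmul _ _ c fun x _ => ?_).trans (by simp)
  split_ifs
  · exact hg x
  · exact Nat.zero_le _

/-- The state after the first `k` edges have been read. -/
structure EdgeInv (es : List (Fin n × Fin n)) (s : Store) (k : ℕ) : Prop where
  reg0 : s.reg 0 = n
  reg1 : s.reg 1 = 0
  reg2 : s.reg 2 = 1
  reg3 : s.reg 3 = es.length
  reg4 : s.reg 4 = k
  reg9 : s.reg 9 = 0
  le : k ≤ es.length
  fst : ∀ i (h : i < es.length), s.arr 0 i = (es[i].1 : ℕ)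
  snd : ∀ i (h : i < es.length), s.arr 1 i = (es[i].2 : ℕ)
  deg : ∀ v : Fin n, s.arr 3 v = edgeSum (fun _ => 1) v (es.take k)
  sum : ∀ v : Fin n, s.arr 4 v = edgeSum (fun x => (x : ℕ)) v (es.take k)
  cnt : ∀ v : Fin n, s.arr 5 v = 0

theorem EdgeInv.step (h : IsEdgeList T es) (hlen : es.length ≤ n) (hW : (n + 1) ^ 2 ≤ W)
    {s : Store} {k : ℕ}
    (hI : EdgeInv es s k) (hk : k < es.length) :
    Runs W edgeBody s fun s' t => EdgeInv es s' (k + 1) ∧ t = 16 := by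
  obtain ⟨⟨u, w⟩, he⟩ : ∃ e, es[k] = e := ⟨_, rfl⟩
  have huw : u ≠ w := by
    have : s(u, w) ∈ T.edgeSet := (h.2 _).1 (List.mem_map.2
      ⟨(u, w), he ▸ List.getElem_mem hk, rfl⟩)
    exact T.ne_of_adj this
  have huw' : (u : ℕ) ≠ w := fun h => huw (Fin.ext h)
  have hnext : ∀ (g : Fin n → ℕ) v, edgeSum g v (es.take (k + 1)) = edgeSum g v (es.take k) +
      ((if u = v then g w else 0) + if w = v then g u else 0) := by
    intro g v
    rw [List.take_succ_eq_append_getElem hk, edgeSum_append, he]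
    simp [edgeSum]
  have hbound : ∀ (g : Fin n → ℕ), (∀ x, g x ≤ n) → ∀ v, edgeSum g v (es.take (k + 1)) ≤ W := by
    intro g hg v
    refine (edgeSum_take_le g v es _).trans ?_
    rw [h.edgeSum_eq]
    refine (restSum_le hg ∅ v).trans (le_trans ?_ hW)
    nlinarith
  have hn : n + 1 ≤ W := le_trans (by nlinarith) hW
  have hnpos : 1 ≤ n := u.pos
  have b1 := fun v => hbound (fun _ => 1) (fun _ => hnpos) v
  have b2 := fun v => hbound (fun x => (x : ℕ)) (fun x => x.2.le) v
  have e1 := fun v => hnext (fun _ => 1) v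
  have e2 := fun v => hnext (fun x => (x : ℕ)) v
  have a0 := hI.fst k hk
  have a1 := hI.snd k hk
  rw [he] at a0 a1
  simp only [] at a0 a1
  unfold edgeBody
  simp only [runs_cons, runs_nil, runs_load, runs_add, runs_store, Store.setReg_reg,
    Store.setReg_arr, Store.setArr_reg, Store.setArr_arr]
  simp [hI.reg4, a0, a1, hI.reg2, hI.deg, hI.sum, huw'.symm]
  have hval : ∀ x y : Fin n, (x : ℕ) = y ↔ y = x := fun x y => by rw [eq_comm, Fin.ext_iff]
  have c1 := b1 u
  have c2 := b1 w
  have c3 := b2 u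
  have c4 := b2 w
  rw [e1] at c1 c2
  rw [e2] at c3 c4
  simp only [huw, huw.symm, if_true, if_false] at c1 c2 c3 c4
  refine ⟨by omega, by omega, by omega, by omega, by omega, ?_⟩
  constructor
  · simp [hI.reg0]
  · simp [hI.reg1]
  · simp [hI.reg2]
  · simp [hI.reg3]
  · simp
  · simp [hI.reg9]
  · exact hk
  · intro i hi
    simpa using hI.fst i hi
  · intro i hi
    simpa using hI.snd i hi
  · intro v
    rw [e1]
    simp only [Store.setReg_arr, Store.setArr_arr, hI.deg, hval]
    grind
  · intro v
    rw [e2]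
    simp only [Store.setReg_arr, Store.setArr_arr, hI.sum, hval]
    grind
  · intro v
    simp [hI.cnt]

/-- The state after the first `i` vertices have been scanned for leaves. -/
structure ScanInv (T : SimpleGraph (Fin n)) (s : Store) (i : ℕ) : Prop where
  reg0 : s.reg 0 = n
  reg1 : s.reg 1 = 0
  reg2 : s.reg 2 = 1
  reg4 : s.reg 4 = i
  reg9 : s.reg 9 = 0
  le : i ≤ n
  deg : ∀ v : Fin n, s.arr 3 v = restSum T (fun _ => 1) ∅ v
  sum : ∀ v : Fin n, s.arr 4 v = restSum T (fun x => (x : ℕ)) ∅ v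
  cnt : ∀ v : Fin n, s.arr 5 v = if (v : ℕ) < i ∧ s.arr 3 v = 1 then 1 else 0
  root : (∃ v : Fin n, (v : ℕ) < i ∧ s.arr 3 v = 1) → ∃ r : Fin n, s.reg 8 = r ∧ s.arr 3 r = 1

theorem ScanInv.step (hW : (n + 1) ^ 2 ≤ W) {s : Store} {i : ℕ} (hI : ScanInv T s i) (hi : i < n) :
    Runs W scanBody s fun s' t => ScanInv T s' (i + 1) ∧ t ≤ 8 := by
  have hn : n + 1 ≤ W := le_trans (by nlinarith) hW
  unfold scanBody
  rw [runs_cons, runs_load]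
  rw [runs_cons]
  by_cases hb : s.arr 3 i = 1
  · refine runs_ite_of_holds (by simp [Test.Holds, hI.reg4, hb, hI.reg2]) ?_
    simp only [runs_cons, runs_nil, runs_store, runs_move, runs_add]
    simp [hI.reg4, hI.reg2]
    refine ⟨by omega, ?_⟩
    constructor
    · simp [hI.reg0]
    · simp [hI.reg1]
    · simp [hI.reg2]
    · simp
    · simp [hI.reg9]
    · exact hi
    · simpa using hI.deg
    · simpa using hI.sum
    · intro v
      have := hI.cnt v
      by_cases hv : (v : ℕ) = i
      · simp [hv, hb]
      · simp [hv]
        rw [this]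
        have : (v : ℕ) < i ↔ (v : ℕ) < i + 1 := by omega
        simp [this]
    · intro _
      exact ⟨⟨i, hi⟩, by simp, by simpa using hb⟩
  · refine runs_ite_of_not_holds (by simp [Test.Holds, hI.reg4, hb, hI.reg2]) ?_
    simp only [runs_cons, runs_nil, runs_skip, runs_add]
    simp [hI.reg4, hI.reg2]
    refine ⟨by omega, ?_⟩
    have hlt : ∀ v : Fin n, s.arr 3 v = 1 → ((v : ℕ) < i ↔ (v : ℕ) < i + 1) := by
      intro v hv
      have : (v : ℕ) ≠ i := fun h => hb (h ▸ hv)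
      omega
    constructor
    · simp [hI.reg0]
    · simp [hI.reg1]
    · simp [hI.reg2]
    · simp
    · simp [hI.reg9]
    · exact hi
    · simpa using hI.deg
    · simpa using hI.sum
    · intro v
      have := hI.cnt v
      simp only [Store.setReg_arr, this]
      by_cases hv : s.arr 3 v = 1
      · simp [hv, hlt v hv]
      · simp [hv]
    · rintro ⟨v, hv1, hv2⟩
      have hv2 : s.arr 3 v = 1 := hv2
      simpa using hI.root ⟨v, (hlt v hv2).2 hv1, hv2⟩

end Program

/-! ### The pruning loop and the running time -/

section Pruning

variable {n W : ℕ} {T : SimpleGraph (Fin n)} {hT : T.IsTree} {r : Fin n} {D L : Set (Fin n)}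
  {S : List (Fin n)}

/-- The state of the machine after the vertices of `D` have been pruned: arrays `3`, `4` and `5`
hold, for each vertex that is left, the number and the sum of its remaining neighbors and
the number of its pending leaves. -/
structure MainInv (hT : T.IsTree) (r : Fin n) (D L : Set (Fin n)) (S : List (Fin n)) (s : Store) :
    Prop where
  reg0 : s.reg 0 = n
  reg2 : s.reg 2 = 1
  reg8 : s.reg 8 = r
  reg9 : s.reg 9 = 0
  greedy : GreedyState hT r D L S
  length_le : S.length ≤ D.ncard
  done : ∀ v ∈ D, s.arr 3 v = 0
  deg_root : s.arr 3 r = 0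
  deg : ∀ v : Fin n, v ∉ D → v ≠ r → s.arr 3 v = restSum T (fun _ => 1) D v
  sum : ∀ v : Fin n, v ∉ D → v ≠ r → s.arr 4 v = restSum T (fun x => (x : ℕ)) D v
  cnt : ∀ v : Fin n, v ∉ D → s.arr 5 v = (pending hT r D L v).ncard
  out : IsOutput s S

theorem ncard_le_card_fin (A : Set (Fin n)) : A.ncard ≤ n := by
  simpa using Set.ncard_le_card A

/-- One pass of the pruning loop. By the last conclusion, only the parent `p` of the pruned vertex
can have become a vertex with one remaining neighbor. -/
theorem MainInv.prune (hW : (n + 1) ^ 2 ≤ W) {s : Store} (hI : MainInv hT r D L S s) {v : Fin n}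
    (h5 : s.reg 5 = v) (hv : s.arr 3 v = 1) :
    v ∉ D ∧ Runs W pruneBody s fun s' t => t ≤ 20 ∧ ∃ L' S' p, MainInv hT r (insert v D) L' S' s' ∧
      s'.reg 4 = s.reg 4 ∧ s'.reg 5 = (p : Fin n) ∧ s'.reg 7 = s'.arr 3 p ∧
      ∀ w : Fin n, w ∉ insert v D → w ≠ p → s'.arr 3 w = s.arr 3 w := by
  have hn : n + 1 ≤ W := le_trans (by nlinarith) hW
  have hvD : v ∉ D := fun h => by have := hI.done v h; omega
  have hv0 : v ≠ r := by
    rintro rfl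
    have := hI.deg_root
    omega
  refine ⟨hvD, ?_⟩
  obtain ⟨p, hp, hpD, hiff, hup⟩ := hI.greedy.of_restSum_eq_one hvD hv0
    (by rw [← hI.deg v hvD hv0, hv])
  have hsum : s.arr 4 v = p := by
    rw [hI.sum v hvD hv0, restSum_of_unique hiff]
  have hpv : p ≠ v := hp.2.2
  have hpv' : (p : ℕ) ≠ v := fun h => hpv (Fin.ext h)
  have hval : ∀ x y : Fin n, (x : ℕ) = y ↔ x = y := fun x y => Fin.ext_iff.symm
  have hcard : S.length + 1 ≤ (insert v D).ncard := by
    rw [Set.ncard_insert_of_notMem hvD]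
    have := hI.length_le
    omega
  have hcardn := ncard_le_card_fin (insert v D)
  -- the effect on the arrays of degrees and of sums, which is the same in both cases
  have hdeg : ∀ w : Fin n, w ∉ insert v D → w ≠ r →
      (if w = p then s.arr 3 p - 1 else s.arr 3 w) = restSum T (fun _ => 1) (insert v D) w := by
    intro w hw hw0
    have hwD : w ∉ D := fun h => hw (Or.inr h)
    by_cases hwp : w = p
    · subst hwp
      rw [if_pos rfl, hI.deg w hwD hw0, restSum_insert_of_adj hp.1.symm hvD]
      rfl
    · rw [if_neg hwp, hI.deg w hwD hw0,
        restSum_insert_of_not_adj (not_adj_of_ne_parent hp hup hwD hwp)]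
  have hsums : ∀ w : Fin n, w ∉ insert v D → w ≠ r →
      (if w = p then s.arr 4 p - v else s.arr 4 w) =
        restSum T (fun x => (x : ℕ)) (insert v D) w := by
    intro w hw hw0
    have hwD : w ∉ D := fun h => hw (Or.inr h)
    by_cases hwp : w = p
    · subst hwp
      rw [if_pos rfl, hI.sum w hwD hw0, restSum_insert_of_adj hp.1.symm hvD]
      simp
    · rw [if_neg hwp, hI.sum w hwD hw0,
        restSum_insert_of_not_adj (not_adj_of_ne_parent hp hup hwD hwp)]
  -- all vertices above `v` have been pruned, so all remaining leaves above it are pending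
  have hcnt := hI.cnt v hvD
  have hpend := pending_eq_of_upper (L := L) hup
  have hdone : ∀ w ∈ insert v D, w ≠ p ∧ (w ≠ v → s.arr 3 w = 0) := by
    rintro w (rfl | hw)
    · exact ⟨hpv.symm, fun h => absurd rfl h⟩
    · exact ⟨by rintro rfl; exact hpD hw, fun _ => hI.done w hw⟩
  have hbuild : ∀ (s' : Store) (L' : Set (Fin n)) (S' : List (Fin n)),
      GreedyState hT r (insert v D) L' S' → S'.length ≤ S.length + 1 →
      s'.reg 0 = s.reg 0 → s'.reg 2 = s.reg 2 → s'.reg 8 = s.reg 8 → s'.reg 9 = s.reg 9 →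
      (∀ w : Fin n, s'.arr 3 w = if w = p then s.arr 3 p - 1 else if w = v then 0 else s.arr 3 w) →
      (∀ w : Fin n, s'.arr 4 w = if w = p then s.arr 4 p - v else s.arr 4 w) →
      (∀ w : Fin n, w ∉ insert v D → s'.arr 5 w = (pending hT r (insert v D) L' w).ncard) →
      IsOutput s' S' → MainInv hT r (insert v D) L' S' s' := by
    intro s' L' S' hg hlen e0 e2 e8 e9 a3 a4 a5 hout
    refine ⟨e0.trans hI.reg0, e2.trans hI.reg2, e8.trans hI.reg8, e9.trans hI.reg9, hg,
      hlen.trans hcard, fun w hw => ?_, ?_, fun w hw hw0 => ?_, fun w hw hw0 => ?_, a5, hout⟩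
    · rw [a3, if_neg (hdone w hw).1]
      by_cases hwv : w = v
      · rw [if_pos hwv]
      · rw [if_neg hwv, (hdone w hw).2 hwv]
    · -- if the parent is the root, its degree stays zero by truncated subtraction
      rw [a3, if_neg hv0.symm, hI.deg_root]
      by_cases hrp : r = p
      · rw [if_pos hrp, ← hrp, hI.deg_root]
      · rw [if_neg hrp]
    · rw [a3, ← hdeg w hw hw0, if_neg (c := w = v) fun h => hw (Or.inl h)]
    · rw [a4, hsums w hw hw0]
  unfold pruneBody
  simp only [runs_cons, runs_load, runs_store, runs_sub, Store.setReg_reg, Store.setReg_arr,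
    Store.setArr_reg, Store.setArr_arr]
  simp only [h5, hsum, hI.reg9, hI.reg2, reduceIte, Nat.reduceEqDiff, true_and, false_and, hpv']
  by_cases hsel : 1 < s.arr 5 v
  · have hab : ∃ a ∈ L, ∃ b ∈ L, a ≠ b ∧ (treeOrder hT r).le v a ∧ (treeOrder hT r).le v b := by
      rw [hcnt, hpend, Set.one_lt_ncard_iff] at hsel
      obtain ⟨a, b, ha, hb, hab⟩ := hsel
      exact ⟨a, ha.1, b, hb.1, hab, ha.2, hb.2⟩
    obtain ⟨a, ha, b, hb, hab, hva, hvb⟩ := hab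
    have hg := hI.greedy.select hv0 hup ha hb hab hva hvb
    refine runs_ite_of_holds (by simpa [Test.Holds, hI.reg2] using hsel) ?_
    simp only [appendReg, runs_cons, runs_nil, runs_store, runs_add, runs_move, Store.setReg_reg,
      Store.setReg_arr, Store.setArr_reg, Store.setArr_arr, reduceIte, Nat.reduceEqDiff, true_and,
      false_and, h5, hI.reg2]
    have h1 := hI.out.1
    refine ⟨by omega, by norm_num, _, _, p, hbuild _ _ _ hg (by simp) (by simp) (by simp) (by simp)
      (by simp) ?_ ?_ ?_ ?_, rfl, by simp, ?_⟩
    · intro w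
      simp [hval]
    · intro w
      simp [hval]
    · intro w hw
      rw [pending_select hvD hup hw]
      simpa using hI.cnt w fun h => hw (Or.inr h)
    · exact hI.out.append (by simp) (by simp)
    · intro w hw hwp
      have hwv : w ≠ v := fun h => hw (Or.inl h)
      simp [hval, hwp, hwv]
  · have hg := hI.greedy.keep hv0 hup (by
      intro a ha b hb hva hvb
      by_contra hab
      refine hsel ?_
      rw [hcnt, hpend, Set.one_lt_ncard_iff]
      exact ⟨a, b, ⟨ha, hva⟩, ⟨hb, hvb⟩, hab⟩)
    refine runs_ite_of_not_holds (by simpa [Test.Holds, hI.reg2] using hsel) ?_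
    simp only [runs_cons, runs_nil, runs_load, runs_store, runs_add, runs_move, Store.setReg_reg,
      Store.setReg_arr, Store.setArr_reg, Store.setArr_arr, reduceIte, Nat.reduceEqDiff, true_and,
      false_and]
    have hcp : s.arr 5 p + s.arr 5 v = (pending hT r (insert v D) L p).ncard := by
      rw [pending_parent hp hup, Set.ncard_union_eq (disjoint_pending hp hvD), ← hI.cnt p hpD, hcnt]
    refine ⟨?_, by norm_num, _, _, p, hbuild _ _ _ hg (by simp) (by simp) (by simp) (by simp)
      (by simp) ?_ ?_ ?_ ?_, rfl, by simp, ?_⟩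
    · rw [hcp]
      exact (ncard_le_card_fin _).trans (by omega)
    · intro w
      simp [hval]
    · intro w
      simp [hval]
    · intro w hw
      by_cases hwp : w = p
      · subst hwp
        simpa using hcp
      · rw [hI.greedy.pending_of_ne hp hvD hw hwp]
        simpa [hval, hwp] using hI.cnt w fun h => hw (Or.inr h)
    · exact hI.out.congr (by simp) (by simp)
    · intro w hw hwp
      have hwv : w ≠ v := fun h => hw (Or.inl h)
      simp [hval, hwp, hwv]

/-- The invariant of the inner loop, with its budget: the current vertex `v` is the only one below
`i + 1` that can have exactly one remaining neighbor. -/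
def ChainInv (hT : T.IsTree) (r : Fin n) (i : ℕ) (s : Store) (m : ℕ) : Prop :=
  ∃ (D L : Set (Fin n)) (S : List (Fin n)) (v : Fin n), MainInv hT r D L S s ∧ s.reg 4 = i ∧
    s.reg 5 = v ∧ s.reg 7 = s.arr 3 v ∧
    (∀ w : Fin n, w ∉ D → w ≠ r → s.arr 3 w = 1 → i + 1 ≤ w ∨ w = v) ∧ m = 40 * (n - D.ncard)

/-- The invariant of the outer loop, with its budget: forty steps for each vertex that has not yet
been visited by the outer loop, and forty for each vertex that has not been pruned. -/
def PruneInv (hT : T.IsTree) (r : Fin n) (s : Store) (m : ℕ) : Prop :=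
  ∃ (D L : Set (Fin n)) (S : List (Fin n)) (i : ℕ), MainInv hT r D L S s ∧ s.reg 4 = i ∧ i ≤ n ∧
    (∀ w : Fin n, w ∉ D → w ≠ r → s.arr 3 w = 1 → i ≤ w) ∧
    m = 40 * (n - i) + 40 * (n - D.ncard)

theorem ChainInv.step (hW : (n + 1) ^ 2 ≤ W) {i : ℕ} (s : Store) (m : ℕ)
    (h : ChainInv hT r i s m) (hb : (Test.eq 7 2).Holds s) :
    Runs W pruneBody s fun s' t => ∃ m', ChainInv hT r i s' m' ∧ 1 + t + m' ≤ m := by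
  obtain ⟨D, L, S, v, hI, h4, h5, h7, hmin, rfl⟩ := h
  have hv : s.arr 3 v = 1 := by
    rw [← h7, ← hI.reg2]
    exact hb
  obtain ⟨hvD, hruns⟩ := hI.prune hW h5 hv
  refine hruns.mono ?_
  rintro s' t ⟨ht, L', S', p, hI', h4', h5', h7', hsame⟩
  have hcard := Set.ncard_insert_of_notMem hvD
  have hle := ncard_le_card_fin (insert v D)
  refine ⟨_, ⟨_, L', S', p, hI', h4'.trans h4, h5', h7', fun w hw hw0 hw1 => ?_, rfl⟩, by omega⟩
  by_cases hwp : w = p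
  · exact Or.inr hwp
  · rw [hsame w hw hwp] at hw1
    exact (hmin w (fun h => hw (Or.inr h)) hw0 hw1).imp_right fun h => absurd (Or.inl h) hw

theorem MainInv.congr {s s' : Store} (h : MainInv hT r D L S s) (harr : s'.arr = s.arr)
    (h0 : s'.reg 0 = s.reg 0) (h1 : s'.reg 1 = s.reg 1) (h2 : s'.reg 2 = s.reg 2)
    (h8 : s'.reg 8 = s.reg 8) (h9 : s'.reg 9 = s.reg 9) : MainInv hT r D L S s' where
  reg0 := h0.trans h.reg0
  reg2 := h2.trans h.reg2
  reg8 := h8.trans h.reg8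
  reg9 := h9.trans h.reg9
  greedy := h.greedy
  length_le := h.length_le
  done := harr ▸ h.done
  deg_root := harr ▸ h.deg_root
  deg := harr ▸ h.deg
  sum := harr ▸ h.sum
  cnt := harr ▸ h.cnt
  out := h.out.congr h1 fun i => by rw [harr]

theorem PruneInv.step (hW : (n + 1) ^ 2 ≤ W) (s : Store) (m : ℕ)
    (h : PruneInv hT r s m) (hb : (Test.lt 4 0).Holds s) :
    Runs W chainBody s fun s' t => ∃ m', PruneInv hT r s' m' ∧ 1 + t + m' ≤ m := by
  obtain ⟨D, L, S, i, hI, h4, hi, hmin, rfl⟩ := h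
  have hn : n + 1 ≤ W := le_trans (by nlinarith) hW
  have hin : i < n := by
    rw [← h4, ← hI.reg0]
    exact hb
  unfold chainBody
  simp only [runs_cons, runs_nil, runs_load, runs_move, runs_add]
  have hstart : ChainInv hT r i ((s.setReg 5 (s.reg 4)).setReg 7
      ((s.setReg 5 (s.reg 4)).arr 3 ((s.setReg 5 (s.reg 4)).reg 5))) (40 * (n - D.ncard)) := by
    refine ⟨D, L, S, ⟨i, hin⟩, hI.congr rfl (by simp) (by simp) (by simp) (by simp) (by simp),
      by simp [h4], by simp [h4], by simp [h4], fun w hw hw0 hw1 => ?_, rfl⟩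
    have := hmin w hw hw0 hw1
    rcases Nat.eq_or_lt_of_le this with h | h
    · exact Or.inr (Fin.ext h.symm)
    · exact Or.inl h
  refine (Runs.loop (fun s m h hb => h.step hW s m hb) hstart).mono ?_
  rintro s' t ⟨m', ⟨D', L', S', v, hI', h4', h5', h7', hmin', rfl⟩, hb', ht⟩
  have hv1 : s'.arr 3 v ≠ 1 := by
    rw [← h7', ← hI'.reg2]
    exact hb'
  refine ⟨by rw [h4', hI'.reg2]; omega, _, ⟨D', L', S', i + 1,
    hI'.congr rfl (by simp) (by simp) (by simp) (by simp) (by simp), by simp [h4', hI'.reg2], hin,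
    fun w hw hw0 hw1 => (hmin' w hw hw0 hw1).resolve_right ?_, rfl⟩, by omega⟩
  rintro rfl
  exact hv1 hw1

/-- After the pruning, the root is selected if two leaves are left; then the output is complete. -/
theorem MainInv.finish (hW : (n + 1) ^ 2 ≤ W) {s : Store} (hI : MainInv hT r D L S s)
    (hD : ∀ v, v ≠ r → v ∈ D) :
    Runs W (block [.load 10 5 8, .ite (.lt 2 10) (appendReg 8) .skip]) s fun s' t =>
      t ≤ 10 ∧ ∃ S', IsOutput s' S' ∧ Returns T S' := by
  have hn : n + 1 ≤ W := le_trans (by nlinarith) hW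
  have hlen := hI.length_le
  have hcardn := ncard_le_card_fin D
  have hpend : (pending hT r D L r) = L := by
    ext a
    refine ⟨fun h => h.1, fun h => ⟨h, (treeOrder hT r).root_le a, fun z hz _ => hD z ?_⟩⟩
    exact TreeOrder.ne_root_of_lt hz
  have hcnt := hI.cnt r hI.greedy.root_notMem
  rw [hpend] at hcnt
  rw [runs_cons, runs_load, runs_cons]
  by_cases hsel : 1 < s.arr 5 r
  · refine runs_ite_of_holds (by simpa [Test.Holds, hI.reg2, hI.reg8] using hsel) ?_
    have hL : L ≠ {r} := by
      rintro rfl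
      rw [Set.ncard_singleton] at hcnt
      omega
    have h1 := hI.out.1
    simp only [appendReg, runs_cons, runs_nil, runs_store, runs_add]
    refine ⟨?_, by norm_num, S ++ [r], hI.out.append ?_ ?_, hI.greedy.returns_of_ne hD hL⟩
    · simp [hI.reg2]
      omega
    · simp [hI.reg2]
    · simp [hI.reg8]
  · refine runs_ite_of_not_holds (by simpa [Test.Holds, hI.reg2, hI.reg8] using hsel) ?_
    have hL : L = {r} := by
      refine Set.eq_singleton_iff_unique_mem.2 ⟨hI.greedy.leaves.root_mem, fun x hx => ?_⟩
      rw [hcnt] at hsel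
      exact (Set.ncard_le_one_iff (Set.toFinite _)).1 (not_lt.1 hsel) hx hI.greedy.leaves.root_mem
    simp only [runs_nil, runs_skip]
    exact ⟨by norm_num, S, hI.out.congr (by simp) (by simp), hI.greedy.returns_of_eq hL⟩

/-- The invariant of the pruning holds after the scan, when the degree of the root is set to zero. -/
theorem ScanInv.mainInv {s s' : Store} (hI : ScanInv T s n) (h8 : s.reg 8 = r)
    (hr : s.arr 3 r = 1) (hreg : ∀ x, x ≠ 4 → s'.reg x = s.reg x)
    (harr : ∀ a j, s'.arr a j = if a = 3 ∧ j = r then 0 else s.arr a j) :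
    MainInv hT r ∅ {v | GeodesicTransversal.deg (ofGraph T) v = 1} [] s' := by
  have hleaf : ∀ v : Fin n, s.arr 3 v = 1 ↔ GeodesicTransversal.deg (ofGraph T) v = 1 := fun v => by
    rw [hI.deg, restSum_one_empty]
  refine ⟨by rw [hreg 0 (by simp), hI.reg0], by rw [hreg 2 (by simp), hI.reg2],
    by rw [hreg 8 (by simp), h8], by rw [hreg 9 (by simp), hI.reg9],
    GreedyState.start ((hleaf r).1 hr), by simp, fun v hv => hv.elim, by simp [harr],
    fun v _ hv => ?_, fun v _ _ => ?_, fun v _ => ?_, ?_⟩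
  · rw [harr, if_neg (fun h => hv (Fin.ext h.2)), hI.deg]
  · rw [harr, if_neg (by simp), hI.sum]
  · rw [harr, if_neg (by simp), hI.cnt, pending_empty]
    by_cases hv : s.arr 3 v = 1
    · have : {a | a ∈ {v | GeodesicTransversal.deg (ofGraph T) v = 1} ∧ a = v} = {v} := by
        ext a
        refine ⟨fun h => h.2, ?_⟩
        rintro rfl
        exact ⟨(hleaf _).1 hv, rfl⟩
      rw [this, Set.ncard_singleton, if_pos ⟨v.2, hv⟩]
    · have : {a | a ∈ {v | GeodesicTransversal.deg (ofGraph T) v = 1} ∧ a = v} = ∅ := by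
        refine Set.eq_empty_iff_forall_notMem.2 ?_
        rintro a ⟨ha, rfl⟩
        exact hv ((hleaf _).2 ha)
      rw [this, Set.ncard_empty, if_neg fun h => hv h.2]
  · exact ⟨by rw [hreg 1 (by simp), hI.reg1]; rfl, fun i hi => absurd hi (by simp)⟩

theorem getD_map_eq {es : List (Fin n × Fin n)} (f : Fin n × Fin n → ℕ) {i : ℕ}
    (hi : i < es.length) : (es.map f).getD i 0 = f es[i] := by
  rw [List.getD_eq_getElem _ _ (by simpa using hi), List.getElem_map]

/-- On a tree with at least two vertices the program outputs, in linear time, the selected vertices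
of an execution of the algorithm. -/
theorem mainProg_runs (hT : T.IsTree) {es : List (Fin n × Fin n)} (hes : IsEdgeList T es)
    (hn2 : 2 ≤ n) (hW : (n + 1) ^ 2 ≤ W) :
    Runs W mainProg (inputStore n es) fun s t =>
      t ≤ 200 * n ∧ ∃ S : List (Fin n), IsOutput s S ∧ Returns T S := by
  have hn : n + 1 ≤ W := le_trans (by nlinarith) hW
  have hlen := hes.length hT
  unfold mainProg
  rw [runs_cons, runs_const]
  refine ⟨by omega, ?_⟩
  rw [runs_cons]
  refine runs_ite_of_not_holds (by simp [Test.Holds, inputStore]; omega) ?_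
  rw [runs_cons, runs_sub, runs_cons]
  have hE : EdgeInv es ((((inputStore n es).setReg 2 1)).setReg 3
      (((inputStore n es).setReg 2 1).reg 0 - ((inputStore n es).setReg 2 1).reg 2)) 0 := by
    constructor
    any_goals simp [inputStore, edgeSum]
    · omega
    · intro i hi
      simpa using getD_map_eq (fun e => (e.1 : ℕ)) hi
    · intro i hi
      simpa using getD_map_eq (fun e => (e.2 : ℕ)) hi
  -- a budget of twenty steps for each edge that has not been read
  refine (Runs.loop (I := fun s m => ∃ k, EdgeInv es s k ∧ m = 20 * (es.length - k)) ?_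
    ⟨0, hE, rfl⟩).mono ?_
  · rintro s m ⟨k, hI, rfl⟩ hb
    have hk : k < es.length := by
      rw [← hI.reg4, ← hI.reg3]
      exact hb
    refine (hI.step hes (by omega) hW hk).mono ?_
    rintro s' t ⟨hI', rfl⟩
    exact ⟨_, ⟨k + 1, hI', rfl⟩, by omega⟩
  rintro s t ⟨m, ⟨k, hI, rfl⟩, hb, ht⟩
  have hk : k = es.length := by
    have : ¬ k < es.length := by
      rw [← hI.reg4, ← hI.reg3]
      exact hb
    have := hI.le
    omega
  subst hk
  rw [runs_cons, runs_const]
  refine ⟨by omega, ?_⟩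
  rw [runs_cons]
  have hS : ScanInv T (s.setReg 4 0) 0 := by
    constructor
    · simp [hI.reg0]
    · simp [hI.reg1]
    · simp [hI.reg2]
    · simp
    · simp [hI.reg9]
    · omega
    · intro v
      simp [hI.deg, hes.edgeSum_eq]
    · intro v
      simp [hI.sum, hes.edgeSum_eq]
    · intro v
      simp [hI.cnt]
    · rintro ⟨v, hv, -⟩
      omega
  -- a budget of twenty steps for each vertex that has not been scanned
  refine (Runs.loop (I := fun s m => ∃ k, ScanInv T s k ∧ m = 20 * (n - k)) ?_
    ⟨0, hS, rfl⟩).mono ?_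
  · rintro s m ⟨k, hI, rfl⟩ hb
    have hk : k < n := by
      rw [← hI.reg4, ← hI.reg0]
      exact hb
    refine (hI.step hW hk).mono ?_
    rintro s' t ⟨hI', ht⟩
    exact ⟨_, ⟨k + 1, hI', rfl⟩, by omega⟩
  rintro s' t' ⟨m, ⟨k, hI', rfl⟩, hb', ht'⟩
  have hk : k = n := by
    have : ¬ k < n := by
      rw [← hI'.reg4, ← hI'.reg0]
      exact hb'
    have := hI'.le
    omega
  subst hk
  have : Nontrivial (Fin k) := Fin.nontrivial_iff_two_le.2 hn2
  obtain ⟨r, h8, hr⟩ := hI'.root (by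
    obtain ⟨v⟩ := hT.connected.nonempty
    obtain ⟨a, ha⟩ : ∃ a, deg (ofGraph T) a = 1 := by
      classical
      obtain ⟨a, ha⟩ := hT.exists_vert_degree_one_of_nontrivial
      refine ⟨a, ?_⟩
      rw [← ha, ← SimpleGraph.card_neighborSet_eq_degree, ← Nat.card_eq_fintype_card]
      rfl
    exact ⟨a, a.2, by rw [hI'.deg, restSum_one_empty, ha]⟩)
  rw [runs_cons, runs_store, runs_cons, runs_const]
  refine ⟨by omega, ?_⟩
  rw [runs_cons]
  have hP : PruneInv hT r ((s'.setArr 3 (s'.reg 8) (s'.reg 9)).setReg 4 0) (80 * k) := by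
    refine ⟨∅, _, [], 0, hI'.mainInv h8 hr ?_ ?_, by simp, by simp, by simp, by simp; ring⟩
    · intro x hx
      simp [hx]
    · intro a j
      simp [h8, hI'.reg9]
  refine (Runs.loop (fun s m h hb => h.step hW s m hb) hP).mono ?_
  rintro s'' t'' ⟨m, ⟨D, L, S, i, hM, h4, hi, hmin, rfl⟩, hb'', ht''⟩
  have hik : ¬ i < k := by
    rw [← h4, ← hM.reg0]
    exact hb''
  have hD : ∀ v, v ≠ r → v ∈ D := by
    refine hM.greedy.mem_of_restSum_ne_one fun w hw hw0 h1 => ?_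
    have := hmin w hw hw0 (by rw [hM.deg w hw hw0, h1])
    have := w.2
    omega
  refine (hM.finish hW hD).mono ?_
  rintro s₃ t₃ ⟨ht₃, S', hout, hret⟩
  rw [runs_nil]
  exact ⟨by omega, S', hout, hret⟩

theorem mainProg_runs_one (hW : 1 ≤ W) (es : List (Fin 1 × Fin 1)) :
    Runs W mainProg (inputStore 1 es) fun s t => t ≤ 200 ∧ IsOutput s [(0 : Fin 1)] := by
  unfold mainProg
  rw [runs_cons, runs_const]
  refine ⟨hW, ?_⟩
  rw [runs_cons]
  refine runs_ite_of_holds (by simp [Test.Holds, inputStore]) ?_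
  simp only [appendReg, runs_cons, runs_nil, runs_store, runs_add]
  refine ⟨by simpa [inputStore] using hW, by norm_num, ?_⟩
  have h0 : IsOutput (n := 1) (inputStore 1 es) [] := ⟨rfl, fun i hi => absurd hi (by simp)⟩
  exact h0.append (S := []) (by simp) (by simp [inputStore])

/-- In the tree with one vertex, this vertex alone is a maximal geodesic. -/
theorem isGtSet_one (T : SimpleGraph (Fin 1)) : IsGtSet T {v | v ∈ [(0 : Fin 1)]} := by
  refine ⟨fun u v p _ => ⟨u, by simpa using Subsingleton.elim u 0, p.start_mem_support⟩,
    fun S' hS' => ?_⟩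
  have hmax : IsMaximalGeodesic T (SimpleGraph.Walk.nil : T.Walk 0 0) := by
    refine ⟨by simp [IsGeodesic], fun x y q hq _ => ?_⟩
    have : x = y := Subsingleton.elim x y
    subst this
    rw [hq]
    simp
  obtain ⟨x, hx, -⟩ := hS' 0 0 _ hmax
  have h1 : {v | v ∈ [(0 : Fin 1)]} ⊆ S' := by
    rintro y -
    rwa [Subsingleton.elim y x]
  exact Set.ncard_le_ncard h1

/-- All numbers are at most `(n + 1) ^ 2`; the larger exponent only serves to have the same constant
in both bounds. -/
theorem linear_time {T : SimpleGraph (Fin n)} (hT : T.IsTree) {es : List (Fin n × Fin n)}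
    (hes : IsEdgeList T es) :
    ∃ (s : Store) (t : ℕ) (S : List (Fin n)),
      Exec ((n + 1) ^ 200) mainProg (inputStore n es) s t ∧ t ≤ 200 * n ∧
      IsOutput s S ∧ IsGtSet T {v | v ∈ S} ∧ (2 ≤ n → Returns T S) := by
  obtain ⟨v⟩ := hT.connected.nonempty
  have hpos := v.pos
  rcases Nat.eq_or_lt_of_le (Nat.succ_le_of_lt hpos) with h | h
  · obtain rfl : n = 1 := h.symm
    obtain ⟨s, t, hE, ht, hout⟩ := mainProg_runs_one (W := (1 + 1) ^ 200) Nat.one_le_two_pow es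
    exact ⟨s, t, _, hE, by omega, hout, isGtSet_one T, fun h => absurd h (by simp)⟩
  · obtain ⟨s, t, hE, ht, S, hout, hret⟩ := mainProg_runs hT hes h (W := (n + 1) ^ 200)
      (Nat.pow_le_pow_right (by omega) (by norm_num))
    refine ⟨s, t, S, hE, ht, hout, ?_, fun _ => hret⟩
    obtain ⟨c, hc, hempty, rfl⟩ := hret
    exact ((algorithm_correct hT (by simpa using Nat.succ_le_of_lt h)).2 c hc).2.2 hempty

end Pruning

end GeodesicTransversal

open GeodesicTransversal in
theorem mainTheorem3 :
    -- correctness of every execution of the algorithm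
    (∀ (V : Type*) [Finite V] (T : SimpleGraph V), T.IsTree → 2 ≤ Nat.card V →
      (∃ c₀ : Config V, IsStart T c₀) ∧
      ∀ c : Config V, Reachable T c →
        -- the loop is left after finitely many passes
        Acc (fun c₂ c₁ : Config V => LoopStep c₁ c₂) c ∧
        -- as long as a vertex is left, there is an end support vertex to continue with
        (c.graph.verts.Nonempty → ∃ c' : Config V, LoopStep c c') ∧
        -- what is returned is a gt-set
        (c.graph.verts = ∅ → IsGtSet T {v | v ∈ c.chosen})) ∧
    -- the algorithm can be carried out in linear time, with words of `O(log n)` bits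
    (∃ (P : Prog) (C : ℕ), ∀ (n : ℕ) (T : SimpleGraph (Fin n)), T.IsTree →
      ∀ es : List (Fin n × Fin n), IsEdgeList T es →
        ∃ (s : Store) (t : ℕ) (S : List (Fin n)),
          Exec ((n + 1) ^ C) P (inputStore n es) s t ∧ t ≤ C * n ∧
          IsOutput s S ∧ IsGtSet T {v | v ∈ S} ∧ (2 ≤ n → Returns T S)) := by
  refine ⟨fun V _ T hT hcard => algorithm_correct hT hcard, mainProg, 200, ?_⟩
  exact fun n T hT es hes => linear_time hT hes
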